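/- For $n\ge 1$ let $p_3(n)$ be the number of partitions of $n$ such that (i) the partition has at least one even part and, if $\lambda$ denotes its largest even part, every positive even number $<\lambda$ appears exactly once, while $\lambda$ may appear any positive number of times; (ii) every odd part is $<\lambda$ and appears an even number of times; here each such partition is counted with weight $(-1)^{e}$, where $e$ is the number of appearances of even parts (counted with multiplicity). Then the power series $\sum_{n\ge1}p_3(n)z^n$ and $\sum_{n\ge 1,\,p_3(n)>0}z^n$ converge for real $|z|<1$, and, as $z\to1^-$ through real values, $$\sum_{n\ge1}p_3(n)z^n=O\left(\frac{1}{1-z}\right),\qquad \sum_{\substack{n\ge1\\ p_3(n)>0}}z^n=O\left(\frac{1}{(1-z)\sqrt{\log\frac{1}{1-z}}}\right).$$ -/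

import Mathlib

open Filter Topology Asymptotics

/-- A partition `p` of `n` is admissible if it has a largest even part `l`, every positive even
number below `l` is a part of `p` exactly once (while `l` itself may be repeated), and every odd
part of `p` is smaller than `l` and appears an even number of times. -/
def IsAdmissible {n : ℕ} (p : n.Partition) : Prop :=
  ∃ l ∈ p.parts, Even l ∧
    (∀ e ∈ p.parts, Even e → e ≤ l) ∧
    (∀ e < l, 0 < e → Even e → p.parts.count e = 1) ∧
    (∀ o ∈ p.parts, Odd o → o < l ∧ Even (p.parts.count o))

/-- The number of appearances of even parts in `p`, counted with multiplicity. -/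
def numEvenParts {n : ℕ} (p : n.Partition) : ℕ :=
  (p.parts.filter (fun e => Even e)).card

open Classical in
/-- The number of admissible partitions of `n`, each weighted by `-1` raised to the number of
appearances of even parts. -/
noncomputable def p3 (n : ℕ) : ℤ :=
  ∑ p : n.Partition with IsAdmissible p, (-1 : ℤ) ^ numEvenParts p

/-! Removing one copy of each of 2, 4, ..., 2N from an admissible partition with largest even part
2N leaves copies of 2N and odd parts below 2N of even multiplicity. With q = z^2 the generating
function is therefore the sum over N ≥ 1 of (-1)^N q^(N(N+1)/2) / ((1 + q^N) (1 - q)(1 - q^3)...(1 -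
q^(2N-1))).

A Bailey pair argument turns this into a partial theta series. The pair has α_m = (1 - q^m) q^(m
choose 2) T_m, where T_m is the sum of (-1)^⌊k/2⌋ q^(⌊k/2⌋^2) over 1 ≤ k ≤ m; its β_N is a product,
by summation by parts and a finite pentagonal identity (`sum_pentagonalTerm`, `baileySum_mul`). The
conjugate pair comes from a telescoping certificate (`conjTerm_recurrence`, `conj_sum_congr`).
Exchanging the two summations gives the sum over m ≥ 1 of (-1)^m q^(m^2) T_m, so `p3_eq_sum`
exhibits p_3(n) as a signed count of representations n = 2(m^2 + j^2) with m ≥ 1 and j = ⌊k/2⌋, 1 ≤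
k ≤ m.

Both bounds follow. Counting pairs (m, k) gives |p_3(0)| + ... + |p_3(K-1)| ≤ K (`sum_abs_p3_le`).
If p_3(n) ≠ 0, then n is a sum of two squares, and such n up to N number O(N / √log N) by the upper
half of Landau's theorem, proved here by elementary means (`exists_card_sum_two_squares_le`). Abel
summation transfers the counting bounds to power series as z → 1. -/

open Finset

/-! ### A finite pentagonal number identity -/

/-- `Q n` plays the role of the inverse of `(1 - q) (1 - q ^ 2) ⋯ (1 - q ^ n)`, extended by zero to
negative indices. -/
structure IsQFactorialInv {R : Type*} [CommRing R] (q : R) (Q : ℤ → R) : Prop where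
  zero : Q 0 = 1
  neg : ∀ n : ℤ, n < 0 → Q n = 0
  succ : ∀ n : ℕ, Q n = Q (n + 1) * (1 - q ^ (n + 1))

/-- The finite product `(1 - q) (1 - q ^ 2) ⋯ (1 - q ^ n)`. -/
def qFactorial {R : Type*} [CommRing R] (q : R) (n : ℕ) : R :=
  ∏ i ∈ range n, (1 - q ^ (i + 1))

/-- The sign and power of `q` with exponent the square of `⌊k / 2⌋`. -/
def halfSq {R : Type*} [CommRing R] (q : R) (k : ℕ) : R :=
  (-1) ^ (k / 2) * q ^ ((k / 2) ^ 2)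

namespace IsQFactorialInv

variable {R : Type*} [CommRing R] {q : R} {Q : ℤ → R}

theorem succ_of_eq (h : IsQFactorialInv q Q) {a b : ℤ} (n : ℕ) (ha : a = n) (hb : b = n + 1) :
    Q a = Q b * (1 - q ^ (n + 1)) := by
  subst ha hb; exact h.succ n

theorem qFactorial_mul (h : IsQFactorialInv q Q) (n : ℕ) : qFactorial q n * Q n = 1 := by
  induction n with
  | zero => simp [qFactorial, h.zero]
  | succ n ih =>
    rw [h.succ n] at ih
    rw [← ih, qFactorial, prod_range_succ, ← qFactorial]
    push_cast
    ring

/-- The pair of consecutive terms, with indices `2 j` and `2 j + 1`, in the finite pentagonal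
identity telescopes. -/
theorem pentagonal_pair (h : IsQFactorialInv q Q) (N j : ℕ) (hj : 0 < j) (v s : R) :
    (1 - q ^ (2 * N)) * (1 - q ^ (2 * N + 1)) *
        (s * (v * q ^ (2 * j)) * Q (N + 1 - 2 * j) * Q (N + 2 * j) +
          s * (v * q ^ (4 * j)) * Q (N - 2 * j) * Q (N + 1 + 2 * j)) -
      (1 + q ^ N) *
        (s * (v * q ^ (2 * j)) * Q (N - 2 * j) * Q (N + 2 * j - 1) +
          s * (v * q ^ (4 * j)) * Q (N - 1 - 2 * j) * Q (N + 2 * j)) =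
    (1 - q ^ (2 * N)) * s * (v * q ^ (6 * j) * q ^ (N + 1)) * Q (N - 1 - 2 * j) * Q (N + 1 + 2 * j)
      + (1 - q ^ (2 * N)) * s * (v * q ^ (N + 1)) * Q (N + 1 - 2 * j) * Q (N + 2 * j - 1) := by
  have c1 : Q (N + 2 * j) = Q (N + 1 + 2 * j) * (1 - q ^ (N + 2 * j + 1)) :=
    h.succ_of_eq _ (by push_cast; ring) (by push_cast; ring)
  have c2 : Q (N + 2 * j - 1) = Q (N + 2 * j) * (1 - q ^ (N + 2 * j - 1 + 1)) :=
    h.succ_of_eq _ (by omega) (by omega)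
  rw [Nat.sub_add_cancel (by omega)] at c2
  rw [c1] at c2
  rcases lt_trichotomy (N + 1) (2 * j) with hlt | heq | hgt
  · rw [h.neg (N + 1 - 2 * j) (by omega), h.neg (N - 2 * j) (by omega),
      h.neg (N - 1 - 2 * j) (by omega)]
    ring
  · have e0 : (N + 1 - 2 * j : ℤ) = 0 := by omega
    have hz : q ^ (2 * j) = q ^ N * q := by rw [← heq, pow_succ]
    have hz4 : q ^ (4 * j) = q ^ (2 * j) * q ^ (2 * j) := by ring
    rw [e0, h.zero, h.neg (N - 2 * j) (by omega), h.neg (N - 1 - 2 * j) (by omega), c1, c2]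
    simp only [pow_add, hz, hz4, mul_comm 2 N, pow_mul]
    ring
  · obtain ⟨i, rfl⟩ : ∃ i, N = 2 * j + i := ⟨N - 2 * j, by omega⟩
    have a1 : Q ((2 * j + i : ℕ) - 2 * j) = Q ((2 * j + i : ℕ) + 1 - 2 * j) * (1 - q ^ (i + 1)) :=
      h.succ_of_eq _ (by push_cast; ring) (by push_cast; ring)
    have a2 : Q ((2 * j + i : ℕ) - 1 - 2 * j) = Q ((2 * j + i : ℕ) - 2 * j) * (1 - q ^ i) := by
      rcases i with _ | i
      · rw [h.neg (((2 * j + 0 : ℕ) : ℤ) - 1 - 2 * j) (by omega)]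
        simp
      · exact h.succ_of_eq _ (by push_cast; ring) (by push_cast; ring)
    rw [a2, a1, c2, c1]
    ring

/-- The `k`-th term of the finite pentagonal identity. -/
def pentagonalTerm (q : R) (Q : ℤ → R) (N k : ℕ) : R :=
  halfSq q k * q ^ (k.choose 2) * Q (N - k) * Q (N + k - 1)

theorem sum_pentagonalTerm_step (h : IsQFactorialInv q Q) (N J : ℕ) (hN : 0 < N) :
    (1 - q ^ (2 * N)) * (1 - q ^ (2 * N + 1)) *
        ∑ k ∈ range (2 * J + 1), pentagonalTerm q Q (N + 1) (k + 1) -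
      (1 + q ^ N) * ∑ k ∈ range (2 * J + 1), pentagonalTerm q Q N (k + 1) =
    (1 - q ^ (2 * N)) * (-1) ^ J * q ^ (N + 1 + 3 * J ^ 2 + 3 * J) * Q (N - 1 - 2 * J) *
      Q (N + 1 + 2 * J) := by
  induction J with
  | zero =>
    have c1 : Q N = Q (N + 1) * (1 - q ^ (N + 1)) := h.succ N
    have c2 : Q (N - 1) = Q N * (1 - q ^ (N - 1 + 1)) :=
      h.succ_of_eq _ (by omega) (by omega)
    rw [Nat.sub_add_cancel (by omega)] at c2
    simp [pentagonalTerm, halfSq]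
    rw [c2, c1]
    ring
  | succ J ih =>
    have hd : ∀ M : ℕ, pentagonalTerm q Q M (2 * J + 1 + 1) =
        (-1) ^ (J + 1) * (q ^ (3 * J ^ 2 + 3 * J) * q ^ (2 * (J + 1))) *
          Q (M - 2 * (J + 1 : ℕ)) * Q (M + 2 * (J + 1 : ℕ) - 1) := by
      intro M
      have e1 : (2 * J + 1 + 1) / 2 = J + 1 := by omega
      have e2 : (2 * J + 1 + 1).choose 2 = (J + 1) * (2 * J + 1) := by
        rw [Nat.choose_two_right]
        exact Nat.div_eq_of_eq_mul_left (by norm_num) (by simp; ring)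
      rw [pentagonalTerm, halfSq, e1, e2]
      push_cast
      ring_nf
    have ho : ∀ M : ℕ, pentagonalTerm q Q M (2 * J + 1 + 1 + 1) =
        (-1) ^ (J + 1) * (q ^ (3 * J ^ 2 + 3 * J) * q ^ (4 * (J + 1))) *
          Q (M - 1 - 2 * (J + 1 : ℕ)) * Q (M + 2 * (J + 1 : ℕ)) := by
      intro M
      have e1 : (2 * J + 1 + 1 + 1) / 2 = J + 1 := by omega
      have e2 : (2 * J + 1 + 1 + 1).choose 2 = (J + 1) * (2 * J + 3) := by
        rw [Nat.choose_two_right]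
        exact Nat.div_eq_of_eq_mul_left (by norm_num) (by simp; ring)
      rw [pentagonalTerm, halfSq, e1, e2]
      push_cast
      ring_nf
    -- The factor q^(3J^2 + 3J) is common to the two new terms; multiplying it by q^(6(J+1))
    -- produces the exponent of the next boundary term.
    have key := h.pentagonal_pair N (J + 1) (Nat.succ_pos J) (q ^ (3 * J ^ 2 + 3 * J))
      ((-1) ^ (J + 1))
    rw [show 2 * (J + 1) + 1 = 2 * J + 1 + 1 + 1 by ring]
    simp only [sum_range_succ _ (2 * J + 1 + 1), sum_range_succ _ (2 * J + 1), hd, ho]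
    have f1 : ((N + 1 : ℕ) : ℤ) - 2 * (J + 1 : ℕ) = N + 1 - 2 * (J + 1 : ℕ) := by push_cast; ring
    have f2 : ((N + 1 : ℕ) : ℤ) + 2 * (J + 1 : ℕ) - 1 = N + 2 * (J + 1 : ℕ) := by push_cast; ring
    have f3 : ((N + 1 : ℕ) : ℤ) - 1 - 2 * (J + 1 : ℕ) = N - 2 * (J + 1 : ℕ) := by push_cast; ring
    have f4 : ((N + 1 : ℕ) : ℤ) + 2 * (J + 1 : ℕ) = N + 1 + 2 * (J + 1 : ℕ) := by push_cast; ring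
    have f5 : (N : ℤ) + 1 - 2 * (J + 1 : ℕ) = N - 1 - 2 * J := by push_cast; ring
    have f6 : (N : ℤ) + 2 * (J + 1 : ℕ) - 1 = N + 1 + 2 * J := by push_cast; ring
    rw [f1, f2, f3, f4]
    rw [f5, f6] at key ⊢
    linear_combination key + ih

/-- The factor 1 - q^(n+1) divides the q-factorial of n + 1, which has inverse Q (n + 1), so it is a
unit and can be cancelled in any ring. -/
theorem one_sub_pow_mul_eq_zero (h : IsQFactorialInv q Q) {n : ℕ} {x : R}
    (hx : (1 - q ^ (n + 1)) * x = 0) : x = 0 := by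
  have h1 := h.qFactorial_mul (n + 1)
  rw [qFactorial, prod_range_succ] at h1
  linear_combination x * (-h1) + (∏ i ∈ range n, (1 - q ^ (i + 1))) * Q (n + 1 : ℕ) * hx

/-- A finite form of Euler's pentagonal number theorem. -/
theorem sum_pentagonalTerm (h : IsQFactorialInv q Q) (N : ℕ) :
    ∑ k ∈ range (N + 1), pentagonalTerm q Q (N + 1) (k + 1) =
      (∏ i ∈ range N, (1 + q ^ (i + 1))) * Q (2 * N + 1) := by
  induction N with
  | zero => simp [pentagonalTerm, halfSq, h.zero]
  | succ N ih =>
    have hzero : ∀ M K : ℕ, M ≤ K → ∑ k ∈ range K, pentagonalTerm q Q M (k + 1) =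
        ∑ k ∈ range M, pentagonalTerm q Q M (k + 1) := by
      intro M K hMK
      refine (sum_subset (range_subset_range.2 hMK) fun k _ hk => ?_).symm
      rw [pentagonalTerm, h.neg _ (by simp at hk; push_cast; omega)]
      ring
    -- With J this large the telescoped boundary term contains Q at a negative index and vanishes,
    -- leaving a first-order recurrence in N that the product side also satisfies.
    have hs := h.sum_pentagonalTerm_step (N + 1) (N + 1) (Nat.succ_pos N)
    rw [hzero (N + 1 + 1) _ (by omega), hzero (N + 1) _ (by omega), ih,
      h.neg (((N + 1 : ℕ) : ℤ) - 1 - 2 * (N + 1 : ℕ)) (by push_cast; omega)] at hs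
    have q1 : Q (2 * N + 1) = Q (2 * N + 2) * (1 - q ^ (2 * N + 1 + 1)) :=
      h.succ_of_eq _ (by push_cast; ring) (by push_cast; ring)
    have q2 : Q (2 * N + 2) = Q (2 * N + 3) * (1 - q ^ (2 * N + 2 + 1)) :=
      h.succ_of_eq _ (by push_cast; ring) (by push_cast; ring)
    rw [q1, q2] at hs
    have f : (2 * (N + 1 : ℕ) + 1 : ℤ) = 2 * N + 3 := by push_cast; ring
    rw [f, prod_range_succ, ← sub_eq_zero]
    apply h.one_sub_pow_mul_eq_zero (n := 2 * N + 1)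
    apply h.one_sub_pow_mul_eq_zero (n := 2 * N + 2)
    rw [show 2 * (N + 1) = 2 * N + 1 + 1 by ring] at hs
    linear_combination hs

/-! ### The Bailey pair -/

/-- The partial sums of the `halfSq` sequence. -/
def halfTheta (q : R) (m : ℕ) : R := ∑ k ∈ range m, halfSq q (k + 1)

/-- The Bailey type sum attached to `halfTheta`. -/
def baileySum (q : R) (Q : ℤ → R) (N : ℕ) : R :=
  ∑ m ∈ range N, (1 - q ^ (m + 1)) * q ^ ((m + 1).choose 2) * halfTheta q (m + 1) *
    (Q (N - (m + 1)) * Q (N + (m + 1)))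

theorem choose_two_succ (n : ℕ) : (n + 1).choose 2 = n.choose 2 + n := by
  rw [Nat.choose_succ_succ' n 1, Nat.choose_one_right, add_comm]

/-- Multiplied by 1 + q^(N+1), the weight of `halfTheta` becomes a difference in m. Summation by
parts then replaces partial sums by their increments `halfSq`, leaving the pentagonal sum. -/
theorem baileySum_mul (h : IsQFactorialInv q Q) (N : ℕ) :
    (1 + q ^ (N + 1)) * baileySum q Q (N + 1) =
      (∏ i ∈ range N, (1 + q ^ (i + 1))) * Q (2 * N + 1) := by
  rw [← h.sum_pentagonalTerm]
  have key : ∀ M ≤ N + 1, (1 + q ^ (N + 1)) * ∑ m ∈ range M, (1 - q ^ (m + 1)) *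
        q ^ ((m + 1).choose 2) * halfTheta q (m + 1) *
        (Q ((N + 1 : ℕ) - (m + 1)) * Q ((N + 1 : ℕ) + (m + 1))) =
      ∑ k ∈ range M, pentagonalTerm q Q (N + 1) (k + 1) -
        halfTheta q M * q ^ ((M + 1).choose 2) * Q (N - M) * Q (N + 1 + M) := by
    intro M hM
    induction M with
    | zero => simp [halfTheta]
    | succ M ih =>
      have ih := ih (by omega)
      obtain ⟨i, rfl⟩ : ∃ i, N = M + i := ⟨N - M, by omega⟩
      have a1 : Q ((M + i : ℕ) - (M + 1 : ℕ)) = Q i * (1 - q ^ i) := by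
        rcases i with _ | i
        · rw [h.neg _ (by push_cast; omega)]; simp
        · exact h.succ_of_eq _ (by push_cast; ring) (by push_cast; ring)
      have c1 : Q ((M + i : ℕ) + 1 + M) = Q (2 * M + i + 2) * (1 - q ^ (2 * M + i + 1 + 1)) :=
        h.succ_of_eq _ (by push_cast; ring) (by push_cast; ring)
      have f1 : (((M + i + 1 : ℕ) : ℤ) - ((M : ℤ) + 1)) = i := by push_cast; ring
      have f2 : (((M + i + 1 : ℕ) : ℤ) + ((M : ℤ) + 1)) = 2 * M + i + 2 := by push_cast; ring
      have f3 : (((M + i + 1 : ℕ) : ℤ) + ((M + 1 : ℕ) : ℤ) - 1) = (M + i : ℕ) + 1 + M := by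
        push_cast; ring
      have f4 : (((M + i : ℕ) : ℤ) + 1 + ((M + 1 : ℕ) : ℤ)) = 2 * M + i + 2 := by
        push_cast; ring
      have f5 : (((M + i + 1 : ℕ) : ℤ) - ((M + 1 : ℕ) : ℤ)) = i := by push_cast; ring
      have f6 : (((M + i : ℕ) : ℤ) - (M : ℤ)) = i := by push_cast; ring
      have hT : halfTheta q (M + 1) = halfTheta q M + halfSq q (M + 1) := by
        rw [halfTheta, sum_range_succ, ← halfTheta]
      rw [sum_range_succ, mul_add, ih, sum_range_succ, pentagonalTerm, f1, f2, f3, f4, f5, f6, a1,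
        c1, hT, choose_two_succ (M + 1)]
      ring
  have hk := key (N + 1) le_rfl
  rw [h.neg (N - (N + 1 : ℕ)) (by push_cast; omega)] at hk
  rw [baileySum, hk]
  ring

/-! ### The conjugate Bailey pair and the exchange of summations -/

/-- The conjugate Bailey summand. -/
def conjTerm (q : R) (Q : ℤ → R) (n m : ℕ) : R :=
  (-1) ^ (n + 1) * q ^ ((n + 2).choose 2) * qFactorial q n * Q (n + 1 - m) * Q (n + 1 + m)

/-- The certificate for the recurrence in `m` satisfied by the sums of `conjTerm`. -/
def conjCert (q : R) (Q : ℤ → R) (n m : ℕ) : R :=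
  (-1) ^ n * (1 - q ^ (2 * m + 1)) * q ^ ((n + 2).choose 2) * qFactorial q n * Q (n - m) *
    Q (n + 1 + m)

theorem conjTerm_recurrence (h : IsQFactorialInv q Q) (n m : ℕ) :
    (1 - q ^ (m + 1)) * conjTerm q Q n (m + 1) + q ^ (m + 1) * (1 - q ^ m) * conjTerm q Q n m =
      conjCert q Q (n + 1) m - conjCert q Q n m := by
  have hP : qFactorial q (n + 1) = qFactorial q n * (1 - q ^ (n + 1)) := by
    rw [qFactorial, prod_range_succ, ← qFactorial]
  have c1 : Q (n + 1 + m) = Q (n + 2 + m) * (1 - q ^ (n + 1 + m + 1)) :=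
    h.succ_of_eq _ (by push_cast; ring) (by push_cast; ring)
  have f1 : ((n : ℤ) + 1 - (m + 1 : ℕ)) = n - m := by push_cast; ring
  have f2 : ((n : ℤ) + 1 + (m + 1 : ℕ)) = n + 2 + m := by push_cast; ring
  have f3 : ((n + 1 : ℕ) : ℤ) - m = n + 1 - m := by push_cast; ring
  have f4 : ((n + 1 : ℕ) : ℤ) + 1 + m = n + 2 + m := by push_cast; ring
  rw [conjTerm, conjTerm, conjCert, conjCert, hP, c1, f1, f2, f3, f4,
    choose_two_succ (n + 2)]
  rcases lt_or_ge (n + 1) m with hlt | hge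
  · rw [h.neg (n - m) (by omega), h.neg (n + 1 - m) (by omega)]
    ring
  rcases eq_or_lt_of_le hge with heq | hgt
  · rw [h.neg (n - m) (by omega), heq]
    ring
  · obtain ⟨i, rfl⟩ : ∃ i, n = m + i := ⟨n - m, by omega⟩
    have a1 : Q ((m + i : ℕ) - m) = Q ((m + i : ℕ) + 1 - m) * (1 - q ^ (i + 1)) :=
      h.succ_of_eq _ (by push_cast; ring) (by push_cast; ring)
    rw [a1]
    ring

/-- Summing the recurrence over n telescopes to the two ends of the certificate. The upper end is
divisible by the modulus, so congruences of this kind replace infinite sums and no topology on the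
ring is needed. -/
theorem conj_sum_congr (h : IsQFactorialInv q Q) (M m : ℕ) :
    q ^ ((M + 2).choose 2) ∣ (1 - q ^ (m + 1)) * ∑ n ∈ range M, conjTerm q Q n (m + 1) -
      (-1) ^ (m + 1) * q ^ ((m + 2).choose 2) := by
  have hrec : ∀ m, (1 - q ^ (m + 1)) * ∑ n ∈ range M, conjTerm q Q n (m + 1) +
      q ^ (m + 1) * ((1 - q ^ m) * ∑ n ∈ range M, conjTerm q Q n m) =
      conjCert q Q M m - conjCert q Q 0 m := by
    intro m
    rw [← sum_range_sub (fun n => conjCert q Q n m), ← mul_assoc, mul_sum, mul_sum,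
      ← sum_add_distrib]
    exact sum_congr rfl fun n _ => h.conjTerm_recurrence n m
  have hdvd : ∀ m, q ^ ((M + 2).choose 2) ∣ conjCert q Q M m := by
    intro m
    rw [conjCert]
    exact Dvd.intro_left ((-1) ^ M * (1 - q ^ (2 * m + 1)) * qFactorial q M * Q (M - m) *
      Q (M + 1 + m)) (by ring)
  induction m with
  | zero =>
    -- At m = 0 the factor 1 - q^0 removes the old sum, and the lower end of the certificate, equal
    -- to q, starts the induction. For larger m the lower end is zero.
    have h0 := hrec 0
    have h1 : Q 0 = Q 1 * (1 - q ^ (0 + 1)) := h.succ_of_eq 0 (by simp) (by simp)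
    have h2 : conjCert q Q 0 0 = q := by
      rw [h.zero] at h1
      simp [conjCert, qFactorial, h.zero] at h1 ⊢
      linear_combination (-q) * h1
    rw [h2] at h0
    convert hdvd 0 using 1
    simp at h0 ⊢
    linear_combination h0
  | succ m ih =>
    have h0 := hrec (m + 1)
    have h2 : conjCert q Q 0 (m + 1) = 0 := by
      rw [conjCert, h.neg _ (by push_cast; omega)]; ring
    rw [h2] at h0
    have := dvd_sub (hdvd (m + 1)) (Dvd.dvd.mul_left ih (q ^ (m + 1 + 1)))
    convert this using 1
    rw [choose_two_succ (m + 2)]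
    linear_combination h0

theorem sum_baileySum_congr (h : IsQFactorialInv q Q) (M : ℕ) :
    q ^ ((M + 2).choose 2) ∣
      ∑ n ∈ range M, (-1) ^ (n + 1) * q ^ ((n + 2).choose 2) * qFactorial q n *
        baileySum q Q (n + 1) -
      ∑ m ∈ range M, (-1) ^ (m + 1) * q ^ ((m + 1) ^ 2) * halfTheta q (m + 1) := by
  have h1 : ∀ n ∈ range M, (-1) ^ (n + 1) * q ^ ((n + 2).choose 2) * qFactorial q n *
        baileySum q Q (n + 1) =
      ∑ m ∈ range M, q ^ ((m + 1).choose 2) * halfTheta q (m + 1) *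
        ((1 - q ^ (m + 1)) * conjTerm q Q n (m + 1)) := by
    intro n hn
    rw [baileySum, mul_sum]
    refine sum_subset_zero_on_sdiff (range_subset_range.2 (by simpa using hn)) ?_ ?_
    · intro m hm
      rw [conjTerm, h.neg _ (by simp at hm; push_cast; omega)]
      ring
    · intro m _
      rw [conjTerm]
      push_cast
      ring
  rw [sum_congr rfl h1, sum_comm, ← sum_sub_distrib]
  refine dvd_sum fun m _ => ?_
  have := Dvd.dvd.mul_left (h.conj_sum_congr M m) (q ^ ((m + 1).choose 2) * halfTheta q (m + 1))
  convert this using 1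
  -- The triangular exponents of the Bailey pair and of its conjugate add up to a square; this is
  -- where the theta exponent arises.
  have e : (m + 1) ^ 2 = (m + 1).choose 2 + (m + 2).choose 2 := by
    rw [choose_two_succ (m + 1)]
    have := choose_two_succ m
    have h3 := Nat.triangle_succ m
    rw [Nat.choose_two_right]
    have : 2 ∣ (m + 1) * (m + 1 - 1) := by
      simpa [mul_comm] using (Nat.even_mul_succ_self m).two_dvd
    obtain ⟨c, hc⟩ := this
    rw [hc, Nat.mul_div_cancel_left _ (by norm_num)]
    simp at hc
    nlinarith
  rw [e, ← mul_sum, ← mul_sum]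
  ring

/-- The product formula for the summands. -/
theorem summand_mul (h : IsQFactorialInv q Q) (N : ℕ) :
    (-1) ^ (N + 1) * q ^ ((N + 2).choose 2) * qFactorial q N * baileySum q Q (N + 1) *
      ((1 + q ^ (N + 1)) * ∏ i ∈ range (N + 1), (1 - q ^ (2 * i + 1))) =
      (-1) ^ (N + 1) * q ^ ((N + 2).choose 2) := by
  -- Separate odd and even exponents in the q-factorial of 2N + 1, and write 1 - q^(2i) as (1 -
  -- q^i)(1 + q^i).
  have hprod : (∏ i ∈ range (N + 1), (1 - q ^ (2 * i + 1))) *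
      (qFactorial q N * ∏ i ∈ range N, (1 + q ^ (i + 1))) = qFactorial q (2 * N + 1) := by
    clear h
    induction N with
    | zero => simp [qFactorial]
    | succ N ih =>
      have : qFactorial q (2 * (N + 1) + 1) =
          qFactorial q (2 * N + 1) * (1 - q ^ (2 * N + 2)) * (1 - q ^ (2 * N + 3)) := by
        rw [qFactorial, show 2 * (N + 1) + 1 = 2 * N + 1 + 1 + 1 by ring, prod_range_succ,
          prod_range_succ, ← qFactorial]
      rw [this, ← ih, prod_range_succ _ (N + 1), prod_range_succ _ N,
        prod_range_succ _ N, qFactorial, prod_range_succ, ← qFactorial]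
      ring
  have h1 := h.baileySum_mul N
  have h2 := h.qFactorial_mul (2 * N + 1)
  push_cast at h2
  rw [← hprod] at h2
  linear_combination (-1) ^ (N + 1) * q ^ ((N + 2).choose 2) * h2 +
    (-1) ^ (N + 1) * q ^ ((N + 2).choose 2) * qFactorial q N *
      (∏ i ∈ range (N + 1), (1 - q ^ (2 * i + 1))) * h1

end IsQFactorialInv

/-! ### Generating function for a fixed largest even part -/

open PowerSeries in
open scoped PowerSeries.WithPiTopology in
theorem tsum_signed_geometric (ε : ℤ) {k : ℕ} (hk : 0 < k) :
    (Summable fun j : ℕ => (ε ^ j) • (X : ℤ⟦X⟧) ^ (k * j)) ∧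
    (∑' j : ℕ, (ε ^ j) • (X : ℤ⟦X⟧) ^ (k * j)) * (1 - ε • X ^ k) = 1 := by
  have hfun : (fun j : ℕ => (ε ^ j) • (X : ℤ⟦X⟧) ^ (k * j)) = fun j => (ε • X ^ k) ^ j := by
    funext j
    rw [smul_pow, pow_mul]
  have h0 : constantCoeff (ε • (X : ℤ⟦X⟧) ^ k) = 0 := by
    simp [hk.ne']
  rw [hfun]
  exact ⟨WithPiTopology.summable_pow_of_constantCoeff_eq_zero h0,
    WithPiTopology.tsum_pow_mul_one_sub_of_constantCoeff_eq_zero h0⟩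

/-- The weight whose partition generating function counts the partitions all of whose parts are
equal to `2 N`, or odd, less than `2 N` and repeated an even number of times. -/
def partWeight (N i c : ℕ) : ℤ :=
  if i = 2 * N then (-1) ^ c else if Odd i ∧ i < 2 * N ∧ Even c then 1 else 0

open PowerSeries in
open scoped PowerSeries.WithPiTopology in
theorem partWeight_factor_top {N : ℕ} (hN : 0 < N) :
    (1 + ∑' j, partWeight N (2 * N) (j + 1) • (X : ℤ⟦X⟧) ^ (2 * N * (j + 1))) *
      (1 + X ^ (2 * N)) = 1 := by
  obtain ⟨hs, ht⟩ := tsum_signed_geometric (-1) (k := 2 * N) (by omega)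
  rw [hs.tsum_eq_zero_add] at ht
  simpa [partWeight] using ht

open PowerSeries in
open scoped PowerSeries.WithPiTopology in
theorem partWeight_factor_odd {N k : ℕ} (hk : k < N) :
    (1 + ∑' j, partWeight N (2 * k + 1) (j + 1) • (X : ℤ⟦X⟧) ^ ((2 * k + 1) * (j + 1))) *
      (1 - X ^ (2 * (2 * k + 1))) = 1 := by
  obtain ⟨hs, ht⟩ := tsum_signed_geometric 1 (k := 2 * (2 * k + 1)) (by omega)
  have hinj : Function.Injective fun j : ℕ => 2 * j := fun a b hab => by simpa using hab
  have hw : ∀ c, partWeight N (2 * k + 1) c = if Even c then 1 else 0 := by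
    intro c
    rw [partWeight, if_neg (by omega)]
    have h1 : Odd (2 * k + 1) := ⟨k, rfl⟩
    have h2 : 2 * k + 1 < 2 * N := by omega
    simp [h1, h2]
  have hcomp : (fun j : ℕ => ((1 : ℤ) ^ j) • (X : ℤ⟦X⟧) ^ (2 * (2 * k + 1) * j)) =
      (fun c : ℕ => partWeight N (2 * k + 1) c • (X : ℤ⟦X⟧) ^ ((2 * k + 1) * c)) ∘
        fun j => 2 * j := by
    funext j
    simp only [Function.comp, hw, one_pow, even_two_mul, if_true]
    ring_nf
  have hsupp : ∀ c ∉ Set.range (fun j : ℕ => 2 * j),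
      partWeight N (2 * k + 1) c • (X : ℤ⟦X⟧) ^ ((2 * k + 1) * c) = 0 := by
    intro c hc
    rw [hw, if_neg, zero_smul]
    rintro ⟨d, rfl⟩
    exact hc ⟨d, by ring⟩
  rw [hcomp] at hs
  rw [hinj.summable_iff hsupp] at hs
  have e : ∑' c : ℕ, partWeight N (2 * k + 1) c • (X : ℤ⟦X⟧) ^ ((2 * k + 1) * c) =
      ∑' j : ℕ, ((1 : ℤ) ^ j) • (X : ℤ⟦X⟧) ^ (2 * (2 * k + 1) * j) := by
    rw [hcomp]
    refine (hinj.tsum_eq fun c hc => ?_).symm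
    by_contra hcr
    exact hc (hsupp c hcr)
  rw [← e, hs.tsum_eq_zero_add, one_smul] at ht
  simpa [hw] using ht

open PowerSeries in
open scoped PowerSeries.WithPiTopology in
theorem genFun_partWeight_mul {N : ℕ} (hN : 0 < N) :
    Nat.Partition.genFun (partWeight N) *
      ((1 + (X : ℤ⟦X⟧) ^ (2 * N)) * ∏ k ∈ range N, (1 - X ^ (2 * (2 * k + 1)))) = 1 := by
  have hp := Nat.Partition.hasProd_genFun (partWeight N)
  -- The product is indexed by part size minus one, so 2N - 1 stands for the part 2N and 2k for the
  -- part 2k + 1.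
  set s : Finset ℕ := insert (2 * N - 1) ((range N).image fun k => 2 * k) with hs
  have hone : ∀ i ∉ s, (1 + ∑' j, partWeight N (i + 1) (j + 1) •
      (X : ℤ⟦X⟧) ^ ((i + 1) * (j + 1))) = 1 := by
    intro i hi
    have h0 : ∀ c, partWeight N (i + 1) c = 0 := by
      intro c
      simp only [hs, mem_insert, mem_image, mem_range, not_or, not_exists, not_and] at hi
      rw [partWeight, if_neg (by omega), if_neg]
      rintro ⟨⟨d, hd⟩, hlt, -⟩
      exact hi.2 d (by omega) (by omega)
    simp [h0]
  have heq := hp.unique (hasProd_prod_of_ne_finset_one hone)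
  rw [heq, hs, prod_insert (by
    simp only [mem_image, mem_range, not_exists, not_and]
    intro x _
    omega), prod_image (by intro a _ b _ hab; simpa using hab), Nat.sub_add_cancel (by omega)]
  have h1 := partWeight_factor_top hN
  have h2 : (∏ k ∈ range N, (1 + ∑' j, partWeight N (2 * k + 1) (j + 1) •
      (X : ℤ⟦X⟧) ^ ((2 * k + 1) * (j + 1)))) * ∏ k ∈ range N, (1 - X ^ (2 * (2 * k + 1))) = 1 := by
    rw [← prod_mul_distrib]
    exact prod_eq_one fun k hk => partWeight_factor_odd (mem_range.1 hk)
  rw [mul_mul_mul_comm]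
  exact (congrArg₂ (· * ·) h1 h2).trans (one_mul 1)

/-! ### Reduction of admissible partitions -/

/-- The multiset `{2, 4, …, 2 N}`. -/
def evensUpTo (N : ℕ) : Multiset ℕ := (Multiset.range N).map fun i => 2 * (i + 1)

theorem count_evensUpTo (N i : ℕ) :
    (evensUpTo N).count i = if Even i ∧ 0 < i ∧ i ≤ 2 * N then 1 else 0 := by
  have hnd : (evensUpTo N).Nodup :=
    (Multiset.nodup_range N).map fun a b hab => by simpa using hab
  have hmem : i ∈ evensUpTo N ↔ Even i ∧ 0 < i ∧ i ≤ 2 * N := by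
    simp only [evensUpTo, Multiset.mem_map, Multiset.mem_range]
    constructor
    · rintro ⟨a, ha, rfl⟩
      exact ⟨even_two_mul _, by omega, by omega⟩
    · rintro ⟨⟨d, rfl⟩, h1, h2⟩
      exact ⟨d - 1, by omega, by omega⟩
  by_cases h : i ∈ evensUpTo N
  · rw [Multiset.count_eq_one_of_mem hnd h, if_pos (hmem.1 h)]
  · rw [Multiset.count_eq_zero_of_notMem h, if_neg (fun h' => h (hmem.2 h'))]

theorem sum_evensUpTo (N : ℕ) : (evensUpTo N).sum = N * (N + 1) := by
  induction N with
  | zero => simp [evensUpTo]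
  | succ N ih =>
    rw [evensUpTo, Multiset.range_succ, Multiset.map_cons, Multiset.sum_cons, ← evensUpTo, ih]
    ring

/-- Admissibility with prescribed largest even part `2 N`. -/
def IsAdmissibleAt {n : ℕ} (N : ℕ) (p : n.Partition) : Prop :=
  2 * N ∈ p.parts ∧ (∀ e ∈ p.parts, Even e → e ≤ 2 * N) ∧
    (∀ e < 2 * N, 0 < e → Even e → p.parts.count e = 1) ∧
    (∀ o ∈ p.parts, Odd o → o < 2 * N ∧ Even (p.parts.count o))

/-- All parts are equal to `2 N`, or odd, less than `2 N` and repeated an even number of times. -/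
def IsReducedAt {n : ℕ} (N : ℕ) (p : n.Partition) : Prop :=
  ∀ i ∈ p.parts, i = 2 * N ∨ (Odd i ∧ i < 2 * N ∧ Even (p.parts.count i))

theorem prod_partWeight {n : ℕ} {N : ℕ} (p : n.Partition) [Decidable (IsReducedAt N p)] :
    p.parts.toFinsupp.prod (partWeight N) =
      if IsReducedAt N p then (-1) ^ (p.parts.count (2 * N)) else 0 := by
  simp only [Finsupp.prod, Multiset.toFinsupp_support, Multiset.toFinsupp_apply]
  split_ifs with h
  · by_cases hm : 2 * N ∈ p.parts
    · rw [prod_eq_single_of_mem (2 * N) (by simpa using hm)]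
      · simp [partWeight]
      · intro b hb hne
        have := h b (by simpa using hb)
        rw [partWeight, if_neg hne, if_pos (by tauto)]
    · rw [Multiset.count_eq_zero_of_notMem hm, pow_zero]
      refine prod_eq_one fun b hb => ?_
      have hb : b ∈ p.parts := by simpa using hb
      have hne : b ≠ 2 * N := fun h' => hm (h' ▸ hb)
      have := h b hb
      rw [partWeight, if_neg hne, if_pos (by tauto)]
  · simp only [IsReducedAt, not_forall] at h
    obtain ⟨i, hi, hn⟩ := h
    refine prod_eq_zero (i := i) (by simpa using hi) ?_
    rw [partWeight, if_neg (by tauto), if_neg (by tauto)]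

theorem isAdmissibleAt_iff_count {n N : ℕ} (hN : 0 < N) (p : n.Partition) :
    IsAdmissibleAt N p ↔ evensUpTo N ≤ p.parts ∧
      ∀ i, 0 < p.parts.count i - (evensUpTo N).count i →
        i = 2 * N ∨ (Odd i ∧ i < 2 * N ∧ Even (p.parts.count i - (evensUpTo N).count i)) := by
  simp only [Multiset.le_iff_count, count_evensUpTo]
  constructor
  · rintro ⟨h1, h2, h3, h4⟩
    have h1' := Multiset.one_le_count_iff_mem.2 h1
    refine ⟨fun i => ?_, fun i hi => ?_⟩
    · split_ifs with h
      · rcases eq_or_lt_of_le h.2.2 with he | hlt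
        · rw [he]; exact h1'
        · rw [h3 i hlt h.2.1 h.1]
      · exact Nat.zero_le _
    · have hmem : i ∈ p.parts := Multiset.one_le_count_iff_mem.1 (by omega)
      have hpos := p.parts_pos hmem
      rcases Nat.even_or_odd i with he | ho
      · rcases eq_or_lt_of_le (h2 i hmem he) with heq | hlt
        · exact Or.inl heq
        · rw [h3 i hlt hpos he, if_pos ⟨he, hpos, hlt.le⟩] at hi
          simp at hi
      · have := h4 i hmem ho
        right
        rw [if_neg (fun hh => Nat.not_even_iff_odd.2 ho hh.1)]
        exact ⟨ho, this.1, by simpa using this.2⟩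
  · rintro ⟨h1, h2⟩
    refine ⟨?_, fun e he hev => ?_, fun e hlt hpos hev => ?_, fun o ho hodd => ?_⟩
    · have := h1 (2 * N)
      rw [if_pos ⟨even_two_mul N, by omega, le_rfl⟩] at this
      exact Multiset.one_le_count_iff_mem.1 this
    · by_contra hlt
      have h3 := h2 e
      rw [if_neg (by tauto)] at h3
      rcases h3 (by simpa [Multiset.count_pos] using he) with h | h
      · omega
      · exact Nat.not_even_iff_odd.2 h.1 hev
    · have h3 := h1 e
      have h4 := h2 e
      rw [if_pos ⟨hev, hpos, hlt.le⟩] at h3 h4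
      by_contra hne
      rcases h4 (by omega) with h | h
      · omega
      · exact Nat.not_even_iff_odd.2 h.1 hev
    · have h3 := h2 o
      rw [if_neg (fun hh => Nat.not_even_iff_odd.2 hodd hh.1)] at h3
      rcases h3 (by simpa [Multiset.count_pos] using ho) with h | h
      · exact absurd hodd (Nat.not_odd_iff_even.2 (h ▸ even_two_mul N))
      · exact ⟨h.2.1, by simpa using h.2.2⟩

theorem isReducedAt_iff_count {n N : ℕ} (p : n.Partition) :
    IsReducedAt N p ↔ ∀ i, 0 < p.parts.count i →
      i = 2 * N ∨ (Odd i ∧ i < 2 * N ∧ Even (p.parts.count i)) := by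
  simp only [IsReducedAt, Multiset.count_pos]

theorem numEvenParts_eq {n a N : ℕ} {p : n.Partition} {r : a.Partition} (hr : IsReducedAt N r)
    (hp : p.parts = r.parts + evensUpTo N) :
    numEvenParts p = r.parts.count (2 * N) + N := by
  rw [numEvenParts, hp, Multiset.filter_add, Multiset.card_add, Multiset.count_eq_card_filter_eq]
  congr 1
  · congr 1
    refine Multiset.filter_congr fun i hi => ?_
    constructor
    · intro he
      rcases hr i hi with h | h
      · exact h.symm
      · exact absurd he (Nat.not_even_iff_odd.2 h.1)
    · rintro rfl
      exact even_two_mul N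
  · rw [Multiset.filter_eq_self.2, evensUpTo, Multiset.card_map, Multiset.card_range]
    intro i hi
    simp only [evensUpTo, Multiset.mem_map, Multiset.mem_range] at hi
    obtain ⟨b, -, rfl⟩ := hi
    exact even_two_mul _

-- Subtracting `evensUpTo N` is a bijection onto the reduced partitions. It lowers the size by
-- N(N+1) and the number of even parts by N, which accounts for the monomial and the sign.
open Classical in
open PowerSeries in
theorem sum_isAdmissibleAt (n : ℕ) {N : ℕ} (hN : 0 < N) :
    ∑ p : n.Partition with IsAdmissibleAt N p, (-1 : ℤ) ^ numEvenParts p =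
      coeff n ((-1) ^ N * (X : ℤ⟦X⟧) ^ (N * (N + 1)) * Nat.Partition.genFun (partWeight N)) := by
  have hc : ((-1 : ℤ⟦X⟧)) ^ N * (X : ℤ⟦X⟧) ^ (N * (N + 1)) * Nat.Partition.genFun (partWeight N) =
      C ((-1) ^ N) * (X ^ (N * (N + 1)) * Nat.Partition.genFun (partWeight N)) := by
    rw [map_pow, map_neg, map_one, mul_assoc]
  rw [hc, coeff_C_mul, coeff_X_pow_mul']
  split_ifs with hle
  · obtain ⟨a, rfl⟩ : ∃ a, n = a + N * (N + 1) := ⟨n - N * (N + 1), by omega⟩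
    rw [Nat.add_sub_cancel, Nat.Partition.coeff_genFun]
    simp only [prod_partWeight]
    rw [← sum_filter, mul_sum]
    refine (sum_bij (fun (r : a.Partition) _ => (⟨r.parts + evensUpTo N, ?_, ?_⟩ :
      (a + N * (N + 1)).Partition)) ?_ ?_ ?_ ?_).symm
    · intro i hi
      rcases Multiset.mem_add.1 hi with h | h
      · exact r.parts_pos h
      · simp only [evensUpTo, Multiset.mem_map] at h
        obtain ⟨b, -, rfl⟩ := h
        omega
    · rw [Multiset.sum_add, r.parts_sum, sum_evensUpTo]
    · intro r hr
      simp only [mem_filter, mem_univ, true_and] at hr ⊢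
      rw [isAdmissibleAt_iff_count hN]
      refine ⟨Multiset.le_add_left _ _, ?_⟩
      simpa only [Multiset.count_add, Nat.add_sub_cancel] using (isReducedAt_iff_count r).1 hr
    · intro r _ r' _ h
      have := congrArg Nat.Partition.parts h
      exact Nat.Partition.ext (by simpa using this)
    · intro p hp
      simp only [mem_filter, mem_univ, true_and] at hp
      rw [isAdmissibleAt_iff_count hN] at hp
      refine ⟨⟨p.parts - evensUpTo N, fun hi => p.parts_pos
        (Multiset.mem_of_le (Multiset.sub_le_self _ _) hi), ?_⟩, ?_, ?_⟩
      · have h1 := congrArg Multiset.sum (tsub_add_cancel_of_le hp.1)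
        rw [Multiset.sum_add, p.parts_sum, sum_evensUpTo] at h1
        omega
      · simp only [mem_filter, mem_univ, true_and]
        rw [isReducedAt_iff_count]
        simpa only [Multiset.count_sub] using hp.2
      · exact Nat.Partition.ext (tsub_add_cancel_of_le hp.1)
    · intro r hr
      simp only [mem_filter, mem_univ, true_and] at hr
      rw [numEvenParts_eq hr rfl, pow_add, mul_comm]
  · rw [mul_zero, filter_false_of_mem, sum_empty]
    intro p _ hp
    apply hle
    have h1 := ((isAdmissibleAt_iff_count hN p).1 hp).1
    have h2 := congrArg Multiset.sum (tsub_add_cancel_of_le h1)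
    rw [Multiset.sum_add, p.parts_sum, sum_evensUpTo] at h2
    omega

open PowerSeries in
theorem p3_eq_coeff {n M : ℕ} (hM : n ≤ M) :
    p3 n = coeff n (∑ k ∈ range M, (-1) ^ (k + 1) * (X : ℤ⟦X⟧) ^ ((k + 1) * (k + 2)) *
      Nat.Partition.genFun (partWeight (k + 1))) := by
  classical
  rw [map_sum]
  have h1 : ∀ k ∈ range M, coeff n ((-1) ^ (k + 1) * (X : ℤ⟦X⟧) ^ ((k + 1) * (k + 2)) *
      Nat.Partition.genFun (partWeight (k + 1))) =
      ∑ p : n.Partition, if IsAdmissibleAt (k + 1) p then (-1 : ℤ) ^ numEvenParts p else 0 := by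
    intro k _
    rw [← sum_filter, sum_isAdmissibleAt n (Nat.succ_pos k)]
  rw [sum_congr rfl h1, sum_comm, p3, sum_filter]
  refine sum_congr rfl fun p _ => ?_
  split_ifs with h
  · obtain ⟨l, hl, ⟨N, hN⟩, h2, h3, h4⟩ := h
    have hlpos := p.parts_pos hl
    have hle : l ≤ n := by
      have := Multiset.le_sum_of_mem hl
      rwa [p.parts_sum] at this
    obtain rfl : l = 2 * (N - 1 + 1) := by omega
    rw [sum_eq_single_of_mem (N - 1) (by simp; omega), if_pos ⟨hl, h2, h3, h4⟩]
    intro k _ hk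
    rw [if_neg]
    rintro ⟨g1, g2, -, -⟩
    have a1 := h2 _ g1 (even_two_mul _)
    have a2 := g2 _ hl (even_two_mul _)
    omega
  · refine (sum_eq_zero fun k _ => ?_).symm
    rw [if_neg]
    rintro ⟨g1, g2, g3, g4⟩
    exact h ⟨_, g1, even_two_mul _, g2, g3, g4⟩

/-! ### The coefficient p_3(n) as a signed count of representations -/

open PowerSeries in
/-- The inverse of the `q`-factorial with base `X ^ 2` in the ring of integral power series. -/
noncomputable def powerSeriesQ (n : ℤ) : ℤ⟦X⟧ :=
  if n < 0 then 0 else invOfUnit (qFactorial (X ^ 2) n.toNat) 1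

open PowerSeries in
theorem isQFactorialInv_powerSeriesQ : IsQFactorialInv ((X : ℤ⟦X⟧) ^ 2) powerSeriesQ := by
  have hmul : ∀ n, qFactorial ((X : ℤ⟦X⟧) ^ 2) n * invOfUnit (qFactorial (X ^ 2) n) 1 = 1 := by
    intro n
    refine mul_invOfUnit _ _ ?_
    simp [qFactorial, map_prod]
  refine ⟨?_, fun n hn => if_pos hn, fun n => ?_⟩
  · have := hmul 0
    simpa [powerSeriesQ, qFactorial] using this
  · have h1 := hmul n
    have h2 := hmul (n + 1)
    have hs : qFactorial ((X : ℤ⟦X⟧) ^ 2) (n + 1) =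
        qFactorial (X ^ 2) n * (1 - (X ^ 2) ^ (n + 1)) := prod_range_succ _ _
    rw [hs] at h2
    rw [powerSeriesQ, powerSeriesQ, if_neg (by omega), if_neg (by omega),
      show ((n : ℤ) + 1).toNat = n + 1 by omega, show (n : ℤ).toNat = n by omega]
    rw [hs]
    linear_combination (invOfUnit (qFactorial ((X : ℤ⟦X⟧) ^ 2) n * (1 - (X ^ 2) ^ (n + 1))) 1) *
      (1 - (X ^ 2) ^ (n + 1)) * h1 - (invOfUnit (qFactorial ((X : ℤ⟦X⟧) ^ 2) n) 1) * h2

open PowerSeries in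
theorem p3_eq_sum (n : ℕ) :
    p3 n = ∑ m ∈ range n, ∑ k ∈ range (m + 1), (-1) ^ (m + 1 + (k + 1) / 2) *
      if n = 2 * ((m + 1) ^ 2 + ((k + 1) / 2) ^ 2) then (1 : ℤ) else 0 := by
  have hQ := isQFactorialInv_powerSeriesQ
  have ht : ∀ k, (-1) ^ (k + 1) * (X : ℤ⟦X⟧) ^ ((k + 1) * (k + 2)) *
      Nat.Partition.genFun (partWeight (k + 1)) =
      (-1) ^ (k + 1) * (X ^ 2) ^ ((k + 2).choose 2) * qFactorial (X ^ 2) k *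
        IsQFactorialInv.baileySum (X ^ 2) powerSeriesQ (k + 1) := by
    intro k
    have h1 := hQ.summand_mul k
    have h2 := genFun_partWeight_mul (Nat.succ_pos k)
    have e1 : ((X : ℤ⟦X⟧) ^ 2) ^ ((k + 2).choose 2) = X ^ ((k + 1) * (k + 2)) := by
      rw [← pow_mul, Nat.choose_two_right]
      congr 1
      rw [Nat.mul_div_cancel']
      · simp; ring
      · simpa [mul_comm] using (Nat.even_mul_succ_self (k + 1)).two_dvd
    have e2 : (1 + ((X : ℤ⟦X⟧) ^ 2) ^ (k + 1)) *
        ∏ i ∈ range (k + 1), (1 - (X ^ 2) ^ (2 * i + 1)) = (1 + (X : ℤ⟦X⟧) ^ (2 * (k + 1))) *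
        ∏ i ∈ range (k + 1), (1 - X ^ (2 * (2 * i + 1))) := by
      simp only [← pow_mul]
    rw [e1, e2] at h1
    rw [e1]
    set D := (1 + (X : ℤ⟦X⟧) ^ (2 * (k + 1))) * ∏ i ∈ range (k + 1), (1 - X ^ (2 * (2 * i + 1)))
    linear_combination (-(Nat.Partition.genFun (partWeight (k + 1)))) * h1 +
      (-1) ^ (k + 1) * X ^ ((k + 1) * (k + 2)) * qFactorial (X ^ 2) k *
        IsQFactorialInv.baileySum (X ^ 2) powerSeriesQ (k + 1) * h2
  have hdvd := hQ.sum_baileySum_congr n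
  rw [p3_eq_coeff le_rfl, sum_congr rfl fun k _ => ht k]
  -- Since q = X^2, the congruence holds modulo X to this power, so it determines the n-th
  -- coefficient.
  have hlt : n < 2 * (n + 2).choose 2 := by
    have : (n + 2).choose 2 = (n + 1).choose 2 + (n + 1) :=
      IsQFactorialInv.choose_two_succ (n + 1)
    omega
  rw [← pow_mul] at hdvd
  have h0 := (X_pow_dvd_iff.1 hdvd) n hlt
  rw [map_sub, sub_eq_zero] at h0
  rw [h0, map_sum]
  refine sum_congr rfl fun m _ => ?_
  rw [IsQFactorialInv.halfTheta, mul_sum, map_sum]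
  refine sum_congr rfl fun k _ => ?_
  have : (-1 : ℤ⟦X⟧) ^ (m + 1) * (X ^ 2) ^ ((m + 1) ^ 2) * halfSq (X ^ 2) (k + 1) =
      C ((-1) ^ (m + 1 + (k + 1) / 2)) * X ^ (2 * ((m + 1) ^ 2 + ((k + 1) / 2) ^ 2)) := by
    rw [halfSq, map_pow, map_neg, map_one]
    ring
  rw [this, coeff_C_mul, coeff_X_pow]

/-! ### Landau's upper bound for sums of two squares -/

/-- Squarefree numbers without prime factors congruent to `3` modulo `4`. -/
def IsGaussSqfree (b : ℕ) : Prop := Squarefree b ∧ ∀ p, p.Prime → p ∣ b → p % 4 ≠ 3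

theorem IsGaussSqfree.of_dvd {b d : ℕ} (hb : IsGaussSqfree b) (hd : d ∣ b) : IsGaussSqfree d :=
  ⟨hb.1.squarefree_of_dvd hd, fun p hp hpd => hb.2 p hp (hpd.trans hd)⟩

theorem IsGaussSqfree.pos {b : ℕ} (hb : IsGaussSqfree b) : 0 < b :=
  Nat.pos_of_ne_zero hb.1.ne_zero

theorem exists_sq_mul_of_eq_sq_add_sq {n x y : ℕ} (hn : 0 < n) (h : n = x ^ 2 + y ^ 2) :
    ∃ a b, 0 < a ∧ IsGaussSqfree b ∧ n = a ^ 2 * b := by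
  obtain ⟨a, b, hab, hsq⟩ := Nat.eq_sq_add_sq_iff_eq_sq_mul.1 ⟨x, y, h⟩
  obtain ⟨d, c, hcd, hd⟩ := Nat.sq_mul_squarefree b
  have hb0 : b ≠ 0 := by rintro rfl; simp at hab; omega
  have hn' : n = (a * c) ^ 2 * d := by rw [hab, ← hcd]; ring
  refine ⟨a * c, d, ?_, ⟨hd, fun p hp hpd => ?_⟩, hn'⟩
  · rcases Nat.eq_zero_or_pos (a * c) with h0 | h0
    · rw [h0] at hn'; simp at hn'; omega
    · exact h0
  · have hdb : d ∣ b := ⟨c ^ 2, by rw [← hcd, mul_comm]⟩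
    exact Nat.mod_four_ne_three_of_mem_primeFactors_of_isSquare_neg_one
      (Nat.mem_primeFactors.2 ⟨hp, hpd.trans hdb, hb0⟩) hsq

open Classical in
/-- The elements of `IsGaussSqfree` up to `N`. -/
noncomputable def gaussSqfree (N : ℕ) : Finset ℕ := (Ioc 0 N).filter IsGaussSqfree

theorem mem_gaussSqfree {N b : ℕ} : b ∈ gaussSqfree N ↔ b ≤ N ∧ IsGaussSqfree b := by
  simp only [gaussSqfree, mem_filter, mem_Ioc]
  exact ⟨fun h => ⟨h.1.2, h.2⟩, fun h => ⟨⟨h.2.pos, h.1⟩, h.2⟩⟩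

/-- Expand log b over the primes p dividing b and write b = pm. The cofactor m is again in the set
and p ≤ N/m, so Chebyshev's bound θ(x) ≤ x log 4 applies for each m. -/
theorem sum_log_gaussSqfree_le (N : ℕ) :
    ∑ b ∈ gaussSqfree N, Real.log b ≤ Real.log 4 * N * ∑ m ∈ gaussSqfree N, (m : ℝ)⁻¹ := by
  have h1 : ∀ b ∈ gaussSqfree N, Real.log b = ∑ p ∈ b.primeFactors, Real.log p := by
    intro b hb
    have := Nat.prod_primeFactors_of_squarefree (mem_gaussSqfree.1 hb).2.1
    conv_lhs => rw [← this]
    rw [Nat.cast_prod, Real.log_prod]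
    intro p hp
    exact_mod_cast (Nat.prime_of_mem_primeFactors hp).ne_zero
  have h2 : ∑ b ∈ gaussSqfree N, ∑ p ∈ b.primeFactors, Real.log p ≤
      ∑ m ∈ gaussSqfree N, ∑ p ∈ Nat.primesLE (N / m), Real.log p := by
    rw [sum_sigma', sum_sigma']
    have hinj : Set.InjOn (fun x : (_ : ℕ) × ℕ => (⟨x.1 / x.2, x.2⟩ : (_ : ℕ) × ℕ))
        ((gaussSqfree N).sigma fun b => b.primeFactors) := by
      rintro ⟨b, p⟩ hx ⟨b', p'⟩ hx' h
      simp only [coe_sigma, Set.mem_sigma_iff, mem_coe, Nat.mem_primeFactors] at hx hx'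
      simp only [Sigma.mk.injEq, heq_eq_eq] at h
      obtain ⟨h1, rfl⟩ := h
      rw [Nat.div_left_inj hx.2.2.1 hx'.2.2.1] at h1
      rw [h1]
    rw [← sum_image (f := fun x : (_ : ℕ) × ℕ => Real.log x.2) hinj]
    refine sum_le_sum_of_subset_of_nonneg ?_ ?_
    · intro y hy
      simp only [mem_image, mem_sigma, Nat.mem_primeFactors] at hy
      obtain ⟨⟨b, p⟩, ⟨hb, hp, hpb, hb0⟩, rfl⟩ := hy
      rw [mem_gaussSqfree] at hb
      simp only [mem_sigma, mem_gaussSqfree, Nat.mem_primesLE]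
      have hdvd : b / p ∣ b := Nat.div_dvd_of_dvd hpb
      refine ⟨⟨(Nat.div_le_self _ _).trans hb.1, hb.2.of_dvd hdvd⟩, ?_, hp⟩
      rw [Nat.le_div_iff_mul_le (Nat.pos_of_dvd_of_pos hdvd hb.2.pos), Nat.mul_div_cancel' hpb]
      exact hb.1
    · rintro ⟨m, p⟩ - -
      exact Real.log_natCast_nonneg p
  rw [sum_congr rfl h1]
  refine h2.trans ?_
  rw [mul_sum]
  refine sum_le_sum fun m hm => ?_
  rw [← Chebyshev.theta_eq_sum_primesLE_log]
  refine (Chebyshev.theta_le_log4_mul_x (Nat.cast_nonneg _)).trans ?_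
  rw [mul_assoc]
  refine mul_le_mul_of_nonneg_left ?_ (Real.log_nonneg (by norm_num))
  rw [← div_eq_mul_inv]
  exact Nat.cast_div_le

/-- A sum of values of a nonnegative antitone function twisted by the character modulo four is at
most its first term. -/
theorem sum_chi_four_mul_le {g : ℕ → ℝ} (hg : ∀ a b, 0 < a → a ≤ b → g b ≤ g a) (K : ℕ) :
    ∑ d ∈ Ioc 0 (4 * K), (ZMod.χ₄ d : ℝ) * g d ≤ g 1 - g (4 * K + 1) := by
  induction K with
  | zero => simp
  | succ K ih =>
    rw [show 4 * (K + 1) = 4 * K + 1 + 1 + 1 + 1 by ring]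
    rw [sum_Ioc_succ_top (by omega), sum_Ioc_succ_top (by omega), sum_Ioc_succ_top (by omega),
      sum_Ioc_succ_top (by omega)]
    have e1 : ZMod.χ₄ (4 * K + 1 : ℕ) = 1 := ZMod.χ₄_nat_one_mod_four (by omega)
    have e2 : ZMod.χ₄ (4 * K + 1 + 1 : ℕ) = 0 := by
      rw [ZMod.χ₄_nat_eq_if_mod_four, if_pos (by omega)]
    have e3 : ZMod.χ₄ (4 * K + 1 + 1 + 1 : ℕ) = -1 := ZMod.χ₄_nat_three_mod_four (by omega)
    have e4 : ZMod.χ₄ (4 * K + 1 + 1 + 1 + 1 : ℕ) = 0 := by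
      rw [ZMod.χ₄_nat_eq_if_mod_four, if_pos (by omega)]
    rw [e1, e2, e3, e4]
    -- The new block contributes g(4K+1) - g(4K+3), and g(4K+3) ≥ g(4K+5); keeping the last term in
    -- the bound makes the induction close.
    have := hg (4 * K + 1 + 1 + 1) (4 * K + 1 + 1 + 1 + 1 + 1) (by omega) (by omega)
    push_cast
    linarith

theorem chi_four_sum_divisors_nonneg (n : ℕ) : 0 ≤ ∑ d ∈ n.divisors, (ZMod.χ₄ d : ℝ) := by
  set χ : DirichletCharacter ℂ 4 := ZMod.χ₄.ringHomComp (Int.castRingHom ℂ) with hχ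
  have hsq : χ ^ 2 = 1 := (ZMod.isQuadratic_χ₄.comp (Int.castRingHom ℂ)).sq_eq_one
  have h := DirichletCharacter.zetaMul_nonneg hsq n
  rw [DirichletCharacter.zetaMul, ArithmeticFunction.coe_zeta_mul_apply] at h
  have e : ∑ d ∈ n.divisors, toArithmeticFunction (χ ·) d =
      ((∑ d ∈ n.divisors, (ZMod.χ₄ d : ℝ) : ℝ) : ℂ) := by
    rw [Complex.ofReal_sum]
    refine sum_congr rfl fun d hd => ?_
    have hd0 : d ≠ 0 := (Nat.pos_of_mem_divisors hd).ne'
    simp [toArithmeticFunction, hd0, hχ, MulChar.ringHomComp_apply]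
  rw [e] at h
  exact_mod_cast h

theorem chi_four_eq_one {n : ℕ} (hn : n ≠ 0) (h : ∀ p, p.Prime → p ∣ n → p % 4 = 1) :
    ZMod.χ₄ n = 1 := by
  induction n using Nat.recOnMul with
  | zero => exact absurd rfl hn
  | one => simp
  | prime p hp => exact ZMod.χ₄_nat_one_mod_four (h p hp dvd_rfl)
  | mul a b ha hb =>
    rw [Nat.cast_mul, map_mul, ha (left_ne_zero_of_mul hn) fun p hp hd => h p hp (hd.mul_right b),
      hb (right_ne_zero_of_mul hn) fun p hp hd => h p hp (hd.mul_left a), one_mul]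

-- Summing over e first leaves χ₄ against the antitone weight (1/d) H(Y/d), H denoting harmonic
-- numbers. The alternating sum is at most its first term H(Y).
open ArithmeticFunction in
theorem sum_chi_four_convolution_le (Y : ℕ) :
    ∑ n ∈ Ioc 0 Y, (toArithmeticFunction (fun d => (ZMod.χ₄ d : ℝ) * (d : ℝ)⁻¹) *
      toArithmeticFunction (fun e => (e : ℝ)⁻¹)) n ≤ 1 + Real.log Y := by
  rw [sum_Ioc_mul_eq_sum_sum]
  set g : ℕ → ℝ := fun d => (d : ℝ)⁻¹ * ∑ e ∈ Ioc 0 (Y / d), (e : ℝ)⁻¹ with hg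
  have hanti : ∀ a b, 0 < a → a ≤ b → g b ≤ g a := by
    intro a b ha hab
    have ha' : (0 : ℝ) < a := by exact_mod_cast ha
    refine mul_le_mul ?_ ?_ (sum_nonneg fun _ _ => by positivity) (by positivity)
    · exact inv_anti₀ ha' (by exact_mod_cast hab)
    · exact sum_le_sum_of_subset_of_nonneg
        (Ioc_subset_Ioc_right (Nat.div_le_div_left hab ha)) fun _ _ _ => by positivity
  have hsum : ∑ n ∈ Ioc 0 Y, toArithmeticFunction (fun d => (ZMod.χ₄ d : ℝ) * (d : ℝ)⁻¹) n *
      ∑ m ∈ Ioc 0 (Y / n), toArithmeticFunction (fun e => (e : ℝ)⁻¹) m =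
      ∑ d ∈ Ioc 0 (4 * Y), (ZMod.χ₄ d : ℝ) * g d := by
    refine sum_subset_zero_on_sdiff (Ioc_subset_Ioc_right (by omega)) ?_ ?_
    · intro d hd
      rw [Finset.mem_sdiff, mem_Ioc, mem_Ioc] at hd
      have hlt : Y < d := by by_contra h; exact hd.2 ⟨hd.1.1, by omega⟩
      simp [hg, Nat.div_eq_of_lt hlt]
    · intro d hd
      have hd0 : d ≠ 0 := (mem_Ioc.1 hd).1.ne'
      have : ∑ m ∈ Ioc 0 (Y / d), toArithmeticFunction (fun e => (e : ℝ)⁻¹) m =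
          ∑ e ∈ Ioc 0 (Y / d), (e : ℝ)⁻¹ :=
        sum_congr rfl fun m hm => by
          simp +contextual [toArithmeticFunction, eq_comm]
      rw [this]
      simp only [toArithmeticFunction, coe_mk, if_neg hd0, hg]
      ring
  rw [hsum]
  refine (sum_chi_four_mul_le hanti Y).trans ?_
  have h1 : 0 ≤ g (4 * Y + 1) := mul_nonneg (by positivity) (sum_nonneg fun _ _ => by positivity)
  have h2 : g 1 = ((harmonic Y : ℚ) : ℝ) := by
    rw [harmonic_eq_sum_Icc]
    simp [hg]
    rfl
  have := harmonic_le_one_add_log Y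
  linarith

-- The square is a sum over products n = m m' ≤ N^2, compared termwise with the sum of r(n)/n, where
-- r = 1 * χ₄ is nonnegative. If n is such a product, all its primes are 1 mod 4, so r(n) counts all
-- its divisors and dominates the number of factorizations.
open Classical in
theorem sum_inv_gaussSqfree_odd_sq_le (N : ℕ) :
    (∑ m ∈ (gaussSqfree N).filter Odd, (m : ℝ)⁻¹) ^ 2 ≤ 1 + Real.log (N ^ 2 : ℕ) := by
  refine le_trans ?_ (sum_chi_four_convolution_le (N ^ 2))
  set u : ArithmeticFunction ℝ :=
    toArithmeticFunction fun m => if IsGaussSqfree m ∧ Odd m then (m : ℝ)⁻¹ else 0 with hu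
  have hu_apply : ∀ m, u m = if IsGaussSqfree m ∧ Odd m then (m : ℝ)⁻¹ else 0 := by
    intro m
    rcases eq_or_ne m 0 with rfl | hm
    · simp
    · simp [hu, toArithmeticFunction, hm]
  have hu_nonneg : ∀ m, 0 ≤ u m := by
    intro m
    rw [hu_apply]
    split_ifs <;> positivity
  have hH : ∑ m ∈ (gaussSqfree N).filter Odd, (m : ℝ)⁻¹ = ∑ m ∈ Ioc 0 N, u m := by
    rw [gaussSqfree, filter_filter, sum_filter]
    exact sum_congr rfl fun m _ => (hu_apply m).symm
  have h1 : (∑ m ∈ Ioc 0 N, u m) ^ 2 ≤ ∑ n ∈ Ioc 0 (N ^ 2), (u * u) n := by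
    rw [ArithmeticFunction.sum_Ioc_mul_eq_sum_sum, sq, sum_mul]
    have hsub : Ioc 0 N ⊆ Ioc 0 (N ^ 2) :=
      Ioc_subset_Ioc_right (Nat.le_self_pow (by norm_num) N)
    refine (sum_le_sum fun m hm => ?_).trans (sum_le_sum_of_subset_of_nonneg hsub fun m _ _ =>
      mul_nonneg (hu_nonneg m) (sum_nonneg fun _ _ => hu_nonneg _))
    rw [mem_Ioc] at hm
    refine mul_le_mul_of_nonneg_left ?_ (hu_nonneg m)
    refine sum_le_sum_of_subset_of_nonneg (Ioc_subset_Ioc_right ?_) fun _ _ _ => hu_nonneg _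
    rw [Nat.le_div_iff_mul_le hm.1, sq]
    exact Nat.mul_le_mul_left N hm.2
  rw [hH]
  refine h1.trans (sum_le_sum fun n hn => ?_)
  have hn0 : n ≠ 0 := (mem_Ioc.1 hn).1.ne'
  rw [ArithmeticFunction.mul_apply, ArithmeticFunction.mul_apply]
  have hrhs : ∀ x ∈ n.divisorsAntidiagonal,
      toArithmeticFunction (fun d => (ZMod.χ₄ d : ℝ) * (d : ℝ)⁻¹) x.1 *
        toArithmeticFunction (fun e => (e : ℝ)⁻¹) x.2 = (n : ℝ)⁻¹ * (ZMod.χ₄ x.1 : ℝ) := by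
    intro x hx
    rw [Nat.mem_divisorsAntidiagonal] at hx
    have hx1 : x.1 ≠ 0 := fun h => hn0 (by rw [← hx.1, h, zero_mul])
    have hx2 : x.2 ≠ 0 := fun h => hn0 (by rw [← hx.1, h, mul_zero])
    simp only [toArithmeticFunction, ArithmeticFunction.coe_mk, if_neg hx1, if_neg hx2]
    rw [← hx.1, Nat.cast_mul, mul_inv]
    ring
  rw [sum_congr rfl hrhs]
  by_cases hex : ∃ x ∈ n.divisorsAntidiagonal, (IsGaussSqfree x.1 ∧ Odd x.1) ∧
      (IsGaussSqfree x.2 ∧ Odd x.2)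
  · obtain ⟨x, hx, ⟨g1, o1⟩, ⟨g2, o2⟩⟩ := hex
    rw [Nat.mem_divisorsAntidiagonal] at hx
    have hprime : ∀ p, p.Prime → p ∣ n → p % 4 = 1 := by
      intro p hp hpn
      have hodd : Odd p := Odd.of_dvd_nat (hx.1 ▸ o1.mul o2) hpn
      have h3 : p % 4 ≠ 3 := by
        rw [← hx.1, hp.dvd_mul] at hpn
        exact hpn.elim (g1.2 p hp) (g2.2 p hp)
      have := Nat.odd_iff.1 hodd
      omega
    refine sum_le_sum fun y hy => ?_
    rw [Nat.mem_divisorsAntidiagonal] at hy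
    have hy1 : y.1 ≠ 0 := fun h => hn0 (by rw [← hy.1, h, zero_mul])
    rw [chi_four_eq_one hy1 fun p hp hd => hprime p hp (hd.trans ⟨y.2, hy.1.symm⟩), ← hy.1,
      hu_apply, hu_apply, Nat.cast_mul, mul_inv]
    push_cast
    rw [mul_one]
    refine mul_le_mul ?_ ?_ ?_ (by positivity) <;> split_ifs <;> first | exact le_rfl | positivity
  · rw [sum_eq_zero]
    · rw [← mul_sum, Nat.sum_divisorsAntidiagonal (f := fun d _ => (ZMod.χ₄ d : ℝ))]
      exact mul_nonneg (by positivity) (chi_four_sum_divisors_nonneg n)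
    · intro x hx
      rw [hu_apply, hu_apply]
      by_contra h
      refine hex ⟨x, hx, ?_, ?_⟩
      · by_contra h'
        rw [if_neg h', zero_mul] at h
        exact h rfl
      · by_contra h'
        rw [if_neg h', mul_zero] at h
        exact h rfl

open Classical in
theorem sum_inv_gaussSqfree_le (N : ℕ) :
    ∑ m ∈ gaussSqfree N, (m : ℝ)⁻¹ ≤ 2 * Real.sqrt (1 + 2 * Real.log N) := by
  set O := (gaussSqfree N).filter Odd with hO
  have h1 : ∑ m ∈ O, (m : ℝ)⁻¹ ≤ Real.sqrt (1 + 2 * Real.log N) := by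
    refine Real.le_sqrt_of_sq_le ?_
    have := sum_inv_gaussSqfree_odd_sq_le N
    rwa [Nat.cast_pow, Real.log_pow] at this
  have h0 : 0 ≤ ∑ m ∈ O, (m : ℝ)⁻¹ := sum_nonneg fun _ _ => by positivity
  -- An even squarefree element is twice an odd one, so the even part costs at most a factor 2
  -- overall.
  have h2 : ∑ m ∈ (gaussSqfree N).filter (fun m => ¬ Odd m), (m : ℝ)⁻¹ ≤ ∑ m ∈ O, (m : ℝ)⁻¹ := by
    have hsub : (gaussSqfree N).filter (fun m => ¬ Odd m) ⊆ O.image (fun m => 2 * m) := by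
      intro m hm
      simp only [mem_filter, mem_gaussSqfree, Nat.not_odd_iff_even] at hm
      obtain ⟨⟨hle, hg⟩, k, rfl⟩ := hm
      have hk : IsGaussSqfree k := hg.of_dvd ⟨2, by ring⟩
      refine mem_image.2 ⟨k, mem_filter.2 ⟨mem_gaussSqfree.2 ⟨by omega, hk⟩, ?_⟩, by ring⟩
      by_contra hodd
      rw [Nat.not_odd_iff_even] at hodd
      obtain ⟨j, rfl⟩ := hodd
      have := hg.1 2 ⟨j, by ring⟩
      simp at this
    refine (sum_le_sum_of_subset_of_nonneg hsub fun _ _ _ => by positivity).trans ?_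
    rw [sum_image (by intro a _ b _ h; simpa using h)]
    refine sum_le_sum fun m hm => ?_
    have hm0 : 0 < m := (mem_gaussSqfree.1 (mem_filter.1 hm).1).2.pos
    have : (0 : ℝ) < m := by exact_mod_cast hm0
    refine inv_anti₀ this ?_
    push_cast
    linarith
  rw [← sum_filter_add_sum_filter_not (gaussSqfree N) Odd]
  linarith

theorem sum_inv_sq_le_two (N : ℕ) : ∑ a ∈ Ioc 0 N, ((a : ℝ) ^ 2)⁻¹ ≤ 2 := by
  rcases Nat.eq_zero_or_pos N with rfl | hN
  · simp
  · have h := sum_Ioc_inv_sq_le_sub (α := ℝ) (k := 1) (n := N) one_ne_zero hN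
    rw [← sum_Ioc_consecutive _ (Nat.zero_le 1) hN]
    have h3 : (0 : ℝ) ≤ (N : ℝ)⁻¹ := by positivity
    simp at h ⊢
    linarith

/-- The pairs `(a, b)` with `a ^ 2 * b ≤ N` and `b` satisfying `IsGaussSqfree`. -/
noncomputable def gaussPairs (N : ℕ) : Finset ((_ : ℕ) × ℕ) :=
  (Ioc 0 N).sigma fun a => gaussSqfree (N / a ^ 2)

theorem sum_log_gaussPairs_le (N : ℕ) :
    ∑ x ∈ gaussPairs N, Real.log x.2 ≤
      4 * Real.log 4 * N * Real.sqrt (1 + 2 * Real.log N) := by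
  rw [gaussPairs, sum_sigma]
  have hH : ∀ a ∈ Ioc 0 N, ∑ b ∈ gaussSqfree (N / a ^ 2), Real.log b ≤
      (2 * Real.log 4 * N * Real.sqrt (1 + 2 * Real.log N)) * ((a : ℝ) ^ 2)⁻¹ := by
    intro a ha
    refine (sum_log_gaussSqfree_le _).trans ?_
    have h1 : ∑ m ∈ gaussSqfree (N / a ^ 2), (m : ℝ)⁻¹ ≤
        2 * Real.sqrt (1 + 2 * Real.log N) := by
      refine le_trans ?_ (sum_inv_gaussSqfree_le N)
      refine sum_le_sum_of_subset_of_nonneg (fun m hm => ?_) fun _ _ _ => by positivity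
      rw [mem_gaussSqfree] at hm ⊢
      exact ⟨hm.1.trans (Nat.div_le_self _ _), hm.2⟩
    have h2 : ((N / a ^ 2 : ℕ) : ℝ) ≤ N * ((a : ℝ) ^ 2)⁻¹ := by
      rw [← div_eq_mul_inv]
      exact_mod_cast Nat.cast_div_le
    have h4 : 0 ≤ Real.log 4 := Real.log_nonneg (by norm_num)
    calc Real.log 4 * ((N / a ^ 2 : ℕ) : ℝ) * ∑ m ∈ gaussSqfree (N / a ^ 2), (m : ℝ)⁻¹
        ≤ Real.log 4 * (N * ((a : ℝ) ^ 2)⁻¹) * (2 * Real.sqrt (1 + 2 * Real.log N)) := by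
          gcongr
      _ = _ := by ring
  refine (sum_le_sum hH).trans ?_
  rw [← mul_sum]
  have h4 : 0 ≤ Real.log 4 := Real.log_nonneg (by norm_num)
  calc 2 * Real.log 4 * N * Real.sqrt (1 + 2 * Real.log N) * ∑ a ∈ Ioc 0 N, ((a : ℝ) ^ 2)⁻¹
      ≤ 2 * Real.log 4 * N * Real.sqrt (1 + 2 * Real.log N) * 2 := by
        gcongr
        exact sum_inv_sq_le_two N
    _ = _ := by ring

theorem card_gaussPairs_mul_log_le (N : ℕ) (hN : 0 < N) :
    ((gaussPairs N).card : ℝ) * Real.log N ≤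
      (Real.sqrt N * Real.sqrt (Real.sqrt N)) * Real.log N +
        16 * Real.log 4 * N * Real.sqrt (1 + 2 * Real.log N) := by
  -- Cut at b about N^(1/4): smaller b give at most N^(3/4) pairs since a ≤ √N, while larger b have
  -- log b ≥ (log N)/4, so the logarithmic sum bounds their number.
  set K := Nat.sqrt (Nat.sqrt N) with hK
  have hlogN : 0 ≤ Real.log N := Real.log_natCast_nonneg N
  have hsmall : (((gaussPairs N).filter fun x => x.2 ≤ K).card : ℝ) ≤
      Real.sqrt N * Real.sqrt (Real.sqrt N) := by
    have hsub : (gaussPairs N).filter (fun x => x.2 ≤ K) ⊆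
        (Ioc 0 (Nat.sqrt N)).sigma fun _ => Ioc 0 K := by
      rintro ⟨a, b⟩ hx
      simp only [gaussPairs, mem_filter, mem_sigma, mem_gaussSqfree, mem_Ioc] at hx ⊢
      obtain ⟨⟨⟨ha, -⟩, hb, hg⟩, hbK⟩ := hx
      refine ⟨⟨ha, ?_⟩, hg.pos, hbK⟩
      rw [Nat.le_sqrt']
      have h1 := hg.pos.trans_le hb
      exact (Nat.div_pos_iff.1 h1).2
    have hcard := card_le_card hsub
    rw [card_sigma] at hcard
    simp only [Nat.card_Ioc, sum_const, smul_eq_mul, tsub_zero] at hcard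
    have h1 : ((Nat.sqrt N : ℕ) : ℝ) ≤ Real.sqrt N := Real.nat_sqrt_le_real_sqrt
    have h2 : (K : ℝ) ≤ Real.sqrt (Real.sqrt N) :=
      (Real.nat_sqrt_le_real_sqrt).trans (Real.sqrt_le_sqrt h1)
    calc (((gaussPairs N).filter fun x => x.2 ≤ K).card : ℝ) ≤ (Nat.sqrt N : ℕ) * (K : ℝ) := by
          exact_mod_cast hcard
      _ ≤ _ := by gcongr
  have hlarge : (((gaussPairs N).filter fun x => ¬ x.2 ≤ K).card : ℝ) * (Real.log N / 4) ≤
      4 * Real.log 4 * N * Real.sqrt (1 + 2 * Real.log N) := by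
    refine le_trans ?_ (sum_log_gaussPairs_le N)
    rw [← nsmul_eq_mul]
    refine (card_nsmul_le_sum _ (fun x => Real.log x.2) _ ?_).trans
      (sum_le_sum_of_subset_of_nonneg (filter_subset _ _)
        fun x _ _ => Real.log_natCast_nonneg _)
    intro x hx
    have hKx : K + 1 ≤ x.2 := by
      have := (mem_filter.1 hx).2
      omega
    have hlt : N ≤ x.2 ^ 4 := by
      have h1 : Nat.sqrt N < (K + 1) ^ 2 := Nat.lt_succ_sqrt' _
      have h2 : N < (Nat.sqrt N + 1) ^ 2 := Nat.lt_succ_sqrt' _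
      calc N ≤ (Nat.sqrt N + 1) ^ 2 := h2.le
        _ ≤ ((K + 1) ^ 2) ^ 2 := Nat.pow_le_pow_left h1 2
        _ = (K + 1) ^ 4 := by ring
        _ ≤ x.2 ^ 4 := Nat.pow_le_pow_left hKx 4
    have h3 : Real.log N ≤ Real.log ((x.2 : ℝ) ^ 4) :=
      Real.log_le_log (by exact_mod_cast hN) (by exact_mod_cast hlt)
    rw [Real.log_pow] at h3
    push_cast at h3
    linarith
  have hsplit := card_filter_add_card_filter_not (s := gaussPairs N) (fun x => x.2 ≤ K)
  have hsplit' : ((gaussPairs N).card : ℝ) =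
      (((gaussPairs N).filter fun x => x.2 ≤ K).card : ℝ) +
        (((gaussPairs N).filter fun x => ¬ x.2 ≤ K).card : ℝ) := by
    exact_mod_cast hsplit.symm
  rw [hsplit', add_mul]
  have := mul_le_mul_of_nonneg_right hsmall hlogN
  linarith

/-- The upper bound in Landau's theorem on the number of sums of two squares. -/
theorem exists_card_sum_two_squares_le : ∃ C : ℝ, 0 < C ∧ ∀ N : ℕ, 2 ≤ N → ∀ s : Finset ℕ,
    (∀ n ∈ s, 0 < n ∧ n ≤ N ∧ ∃ x y, n = x ^ 2 + y ^ 2) →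
      (s.card : ℝ) ≤ C * (N / Real.sqrt (Real.log N)) := by
  -- The 2 absorbs the N^(3/4) term through √L ≤ 2 N^(1/4), with L = log N; 64 is 16 times the 4 in
  -- √(1 + 2L) ≤ 4√L.
  refine ⟨2 + 64 * Real.log 4, by positivity, fun N hN s hs => ?_⟩
  have hN0 : (0 : ℝ) < N := by positivity
  have hcard : s.card ≤ (gaussPairs N).card := by
    refine card_le_card_of_surjOn (fun x => x.1 ^ 2 * x.2) fun n hn => ?_
    obtain ⟨hn0, hnN, x, y, hxy⟩ := hs n hn
    obtain ⟨a, b, ha, hb, rfl⟩ := exists_sq_mul_of_eq_sq_add_sq hn0 hxy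
    refine ⟨⟨a, b⟩, ?_, rfl⟩
    simp only [gaussPairs, coe_sigma, Set.mem_sigma_iff, mem_coe, mem_Ioc, mem_gaussSqfree]
    refine ⟨⟨ha, ?_⟩, ?_, hb⟩
    · calc a ≤ a ^ 2 := Nat.le_self_pow (by norm_num) a
        _ ≤ a ^ 2 * b := Nat.le_mul_of_pos_right _ hb.pos
        _ ≤ N := hnN
    · rw [Nat.le_div_iff_mul_le (by positivity), mul_comm]
      exact hnN
  have hL : 1 / 2 < Real.log N := by
    have h1 : Real.log 2 ≤ Real.log N := Real.log_le_log (by norm_num) (by exact_mod_cast hN)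
    have := Real.log_two_gt_d9
    linarith
  set L := Real.log N with hLdef
  have hL0 : 0 < L := by linarith
  have hsL : 0 < Real.sqrt L := Real.sqrt_pos.2 hL0
  have hmain := card_gaussPairs_mul_log_le N (by omega)
  have hs1 : Real.sqrt (1 + 2 * L) ≤ 4 * Real.sqrt L := by
    rw [show (4 : ℝ) * Real.sqrt L = Real.sqrt (16 * L) by
      rw [Real.sqrt_mul (by norm_num), show (16 : ℝ) = 4 ^ 2 by norm_num, Real.sqrt_sq (by norm_num)]]
    exact Real.sqrt_le_sqrt (by linarith)
  have hs2 : Real.sqrt L ≤ 2 * Real.sqrt (Real.sqrt N) := by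
    rw [show (2 : ℝ) * Real.sqrt (Real.sqrt N) = Real.sqrt (4 * Real.sqrt N) by
      rw [Real.sqrt_mul (by norm_num), show (4 : ℝ) = 2 ^ 2 by norm_num, Real.sqrt_sq (by norm_num)]]
    refine Real.sqrt_le_sqrt ?_
    have h1 : L = 2 * Real.log (Real.sqrt N) := by
      rw [hLdef, Real.log_sqrt hN0.le]; ring
    have h2 := Real.log_le_sub_one_of_pos (Real.sqrt_pos.2 hN0)
    have := Real.sqrt_nonneg (N : ℝ)
    linarith
  have hsN : Real.sqrt (Real.sqrt N) * Real.sqrt (Real.sqrt N) = Real.sqrt N :=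
    Real.mul_self_sqrt (Real.sqrt_nonneg _)
  have hNN : Real.sqrt N * Real.sqrt N = N := Real.mul_self_sqrt hN0.le
  have hLL : Real.sqrt L * Real.sqrt L = L := Real.mul_self_sqrt hL0.le
  have h4 : 0 ≤ Real.log 4 := Real.log_nonneg (by norm_num)
  have hfirst : Real.sqrt N * Real.sqrt (Real.sqrt N) * L ≤ 2 * N * Real.sqrt L := by
    calc Real.sqrt N * Real.sqrt (Real.sqrt N) * L
        = Real.sqrt N * Real.sqrt (Real.sqrt N) * Real.sqrt L * Real.sqrt L := by
          rw [mul_assoc _ (Real.sqrt L), hLL]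
      _ ≤ Real.sqrt N * Real.sqrt (Real.sqrt N) * (2 * Real.sqrt (Real.sqrt N)) *
            Real.sqrt L := by gcongr
      _ = 2 * (Real.sqrt N * (Real.sqrt (Real.sqrt N) * Real.sqrt (Real.sqrt N))) *
            Real.sqrt L := by ring
      _ = 2 * N * Real.sqrt L := by rw [hsN, hNN]
  have hsecond : 16 * Real.log 4 * N * Real.sqrt (1 + 2 * L) ≤
      64 * Real.log 4 * N * Real.sqrt L := by
    calc 16 * Real.log 4 * N * Real.sqrt (1 + 2 * L)
        ≤ 16 * Real.log 4 * N * (4 * Real.sqrt L) := by gcongr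
      _ = _ := by ring
  have hfin : ((gaussPairs N).card : ℝ) * Real.sqrt L ≤ (2 + 64 * Real.log 4) * N := by
    refine le_of_mul_le_mul_right ?_ hsL
    rw [mul_assoc, hLL]
    linarith
  have hc : (s.card : ℝ) ≤ ((gaussPairs N).card : ℝ) := by exact_mod_cast hcard
  rw [← mul_div_assoc, le_div_iff₀ hsL]
  exact (mul_le_mul_of_nonneg_right hc hsL.le).trans hfin

/-! ### Abel summation: from partial sums to power series -/

theorem sum_mul_pow_le_of_sum_le {f g : ℕ → ℝ}
    (h : ∀ K, ∑ n ∈ range K, f n ≤ ∑ n ∈ range K, g n) {z : ℝ} (h0 : 0 ≤ z) (h1 : z ≤ 1) (K : ℕ) :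
    ∑ n ∈ range K, f n * z ^ n ≤ ∑ n ∈ range K, g n * z ^ n := by
  -- This strengthening makes the induction work: the partial sums of g - f are nonnegative and z^K
  -- is decreasing.
  have key : (∑ n ∈ range K, (g n - f n)) * z ^ K ≤ ∑ n ∈ range K, (g n - f n) * z ^ n := by
    induction K with
    | zero => simp
    | succ K ih =>
      rw [sum_range_succ (fun n => (g n - f n) * z ^ n) K]
      have hD : 0 ≤ ∑ n ∈ range (K + 1), (g n - f n) := by
        rw [sum_sub_distrib]
        exact sub_nonneg.2 (h _)
      have hz : z ^ (K + 1) ≤ z ^ K := pow_le_pow_of_le_one h0 h1 (Nat.le_succ K)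
      have := mul_le_mul_of_nonneg_left hz hD
      rw [sum_range_succ] at this ⊢
      linarith
  have hD : 0 ≤ (∑ n ∈ range K, (g n - f n)) * z ^ K := by
    rw [sum_sub_distrib]
    exact mul_nonneg (sub_nonneg.2 (h _)) (pow_nonneg h0 K)
  simp only [sub_mul, sum_sub_distrib] at key hD ⊢
  linarith

theorem sum_mul_pow_le_of_sum_le_affine {f : ℕ → ℝ} {A B : ℝ} (hA : 0 ≤ A) (hB : 0 ≤ B)
    (h : ∀ K : ℕ, ∑ n ∈ range K, f n ≤ A + B * K) {z : ℝ} (h0 : 0 ≤ z) (h1 : z < 1) (K : ℕ) :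
    ∑ n ∈ range K, f n * z ^ n ≤ A + B * (1 / (1 - z)) := by
  have hg : ∀ K, ∑ n ∈ range K, f n ≤ ∑ n ∈ range K, ((if n = 0 then A else 0) + B) := by
    intro K
    rcases K with _ | K
    · simp
    · refine (h _).trans (le_of_eq ?_)
      rw [sum_add_distrib, sum_ite_eq' (range (K + 1)) 0 (fun _ => A), if_pos (by simp)]
      simp [mul_comm]
  refine (sum_mul_pow_le_of_sum_le hg h0 h1.le K).trans ?_
  simp only [add_mul, sum_add_distrib, ← mul_sum]
  refine add_le_add ?_ (mul_le_mul_of_nonneg_left ?_ hB)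
  · simp only [ite_mul, zero_mul]
    rw [sum_ite_eq' (range K) 0 (fun n => A * z ^ n)]
    split_ifs <;> simp [hA]
  · rw [one_div, ← tsum_geometric_of_lt_one h0 h1]
    exact (summable_geometric_of_lt_one h0 h1).sum_le_tsum _ fun n _ => pow_nonneg h0 n

/-! ### Bounds for p_3 and its power series -/

theorem abs_p3_le (n : ℕ) : |p3 n| ≤ ∑ m ∈ range n, ∑ k ∈ range (m + 1),
    if n = 2 * ((m + 1) ^ 2 + ((k + 1) / 2) ^ 2) then (1 : ℤ) else 0 := by
  rw [p3_eq_sum]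
  refine (abs_sum_le_sum_abs _ _).trans (sum_le_sum fun m _ => ?_)
  refine (abs_sum_le_sum_abs _ _).trans (sum_le_sum fun k _ => ?_)
  rw [abs_mul, abs_pow, abs_neg, abs_one, one_pow, one_mul]
  split_ifs <;> simp

/-- A representation of some n < K forces 2(m+1)^2 < K, so there are at most √K values of m, each
with m + 1 ≤ √K values of k. -/
theorem sum_abs_p3_le (K : ℕ) : ∑ n ∈ range K, |p3 n| ≤ K := by
  have h1 : ∑ n ∈ range K, |p3 n| ≤ ∑ m ∈ range K, ∑ k ∈ range (m + 1), ∑ n ∈ range K,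
      if n = 2 * ((m + 1) ^ 2 + ((k + 1) / 2) ^ 2) then (1 : ℤ) else 0 := by
    calc ∑ n ∈ range K, |p3 n| ≤ ∑ n ∈ range K, ∑ m ∈ range K, ∑ k ∈ range (m + 1),
          if n = 2 * ((m + 1) ^ 2 + ((k + 1) / 2) ^ 2) then (1 : ℤ) else 0 := by
          refine sum_le_sum fun n hn => (abs_p3_le n).trans ?_
          refine sum_le_sum_of_subset_of_nonneg
            (range_subset_range.2 (mem_range.1 hn).le) fun m _ _ => sum_nonneg fun k _ => ?_
          split_ifs <;> simp
      _ = _ := by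
          rw [sum_comm]
          exact sum_congr rfl fun m _ => sum_comm
  have h2 : ∀ m ∈ range K, (∑ k ∈ range (m + 1), ∑ n ∈ range K,
      if n = 2 * ((m + 1) ^ 2 + ((k + 1) / 2) ^ 2) then (1 : ℤ) else 0) ≤
      if m < Nat.sqrt K then (Nat.sqrt K : ℤ) else 0 := by
    intro m _
    simp only [sum_ite_eq' (range K), mem_range]
    split_ifs with hm
    · calc ∑ k ∈ range (m + 1), (if 2 * ((m + 1) ^ 2 + ((k + 1) / 2) ^ 2) < K then (1 : ℤ) else 0)
          ≤ ∑ k ∈ range (m + 1), (1 : ℤ) := sum_le_sum fun k _ => by split_ifs <;> simp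
        _ ≤ Nat.sqrt K := by simp; omega
    · refine (sum_eq_zero fun k _ => if_neg fun hlt => hm ?_).le
      have : m + 1 ≤ Nat.sqrt K := by
        rw [Nat.le_sqrt']
        nlinarith
      omega
  refine h1.trans ((sum_le_sum h2).trans ?_)
  rw [← sum_filter, sum_const, nsmul_eq_mul]
  have h3 : ((range K).filter fun m => m < Nat.sqrt K).card ≤ Nat.sqrt K := by
    calc _ ≤ (range (Nat.sqrt K)).card := card_le_card fun m hm => by
            simpa using (mem_filter.1 hm).2
      _ = _ := card_range _
  have h4 := Nat.sqrt_le K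
  calc (((range K).filter fun m => m < Nat.sqrt K).card : ℤ) * (Nat.sqrt K : ℤ)
      ≤ (Nat.sqrt K : ℤ) * (Nat.sqrt K : ℤ) := by gcongr
    _ ≤ K := by exact_mod_cast h4

theorem exists_sq_add_sq_of_p3_ne_zero {n : ℕ} (h : p3 n ≠ 0) : ∃ x y, n = x ^ 2 + y ^ 2 := by
  rw [p3_eq_sum] at h
  obtain ⟨m, -, hm⟩ := exists_ne_zero_of_sum_ne_zero h
  obtain ⟨k, -, hk⟩ := exists_ne_zero_of_sum_ne_zero hm
  have hn : n = 2 * ((m + 1) ^ 2 + ((k + 1) / 2) ^ 2) := by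
    by_contra hne
    rw [if_neg hne, mul_zero] at hk
    exact hk rfl
  -- As 2 = 1^2 + 1^2, twice a sum of two squares is again one.
  obtain ⟨r, s, hrs⟩ := Nat.sq_add_sq_mul (show 2 = 1 ^ 2 + 1 ^ 2 by norm_num)
    (rfl : (m + 1) ^ 2 + ((k + 1) / 2) ^ 2 = _)
  exact ⟨r, s, hn.trans hrs⟩

theorem sum_abs_p3_mul_pow_le {z : ℝ} (h0 : 0 ≤ z) (h1 : z < 1) (K : ℕ) :
    ∑ n ∈ range K, |(p3 n : ℝ)| * z ^ n ≤ 1 / (1 - z) := by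
  have := sum_mul_pow_le_of_sum_le_affine (f := fun n => |(p3 n : ℝ)|) (A := 0) (B := 1) le_rfl
    zero_le_one (fun K => by
      have := sum_abs_p3_le K
      rw [zero_add, one_mul]
      exact_mod_cast this) h0 h1 K
  simpa using this

theorem summable_abs_p3 {z : ℝ} (hz : |z| < 1) : Summable fun n : ℕ => |(p3 n : ℝ)| * |z| ^ n :=
  summable_of_sum_range_le (fun _ => by positivity)
    (sum_abs_p3_mul_pow_le (abs_nonneg z) hz)

theorem summable_p3 {z : ℝ} (hz : |z| < 1) : Summable fun n : ℕ => (p3 n : ℝ) * z ^ n := by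
  refine Summable.of_norm ?_
  simpa [abs_mul, abs_pow] using summable_abs_p3 hz

theorem abs_tsum_p3_le {z : ℝ} (h0 : 0 ≤ z) (h1 : z < 1) :
    |∑' n : {n : ℕ // 1 ≤ n}, (p3 n : ℝ) * z ^ (n : ℕ)| ≤ 1 / (1 - z) := by
  have hz : |z| < 1 := by rwa [abs_of_nonneg h0]
  have hs := summable_abs_p3 hz
  rw [abs_of_nonneg h0] at hs
  have hs' : Summable fun n : {n : ℕ // 1 ≤ n} => |(p3 n : ℝ)| * z ^ (n : ℕ) :=
    hs.comp_injective Subtype.val_injective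
  calc |∑' n : {n : ℕ // 1 ≤ n}, (p3 n : ℝ) * z ^ (n : ℕ)|
      ≤ ∑' n : {n : ℕ // 1 ≤ n}, |(p3 n : ℝ)| * z ^ (n : ℕ) := by
        have := norm_tsum_le_tsum_norm (f := fun n : {n : ℕ // 1 ≤ n} => (p3 n : ℝ) * z ^ (n : ℕ))
          (by simpa [abs_mul, abs_pow, abs_of_nonneg h0] using hs')
        simpa [abs_mul, abs_pow, abs_of_nonneg h0] using this
    _ ≤ ∑' n : ℕ, |(p3 n : ℝ)| * z ^ n :=
        hs.tsum_subtype_le (fun n => |(p3 n : ℝ)| * z ^ n) {n | 1 ≤ n}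
          (fun n => by positivity)
    _ ≤ 1 / (1 - z) :=
        Real.tsum_le_of_sum_range_le (fun n => by positivity) (sum_abs_p3_mul_pow_le h0 h1)

/-- A set of positive sums of two squares has a generating function of Landau size near `1`. -/
theorem exists_tsum_pow_le_of_sum_two_squares (S : Set ℕ)
    (hS : ∀ n ∈ S, 0 < n ∧ ∃ x y, n = x ^ 2 + y ^ 2) :
    ∃ C : ℝ, ∀ z : ℝ, 3 / 4 ≤ z → z < 1 → ∑' n : S, z ^ (n : ℕ) ≤
      C * (1 / ((1 - z) * Real.sqrt (Real.log (1 / (1 - z))))) := by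
  classical
  obtain ⟨C, hC, hcount⟩ := exists_card_sum_two_squares_le
  refine ⟨1 + 2 * C, fun z hz3 hz1 => ?_⟩
  have hz0 : 0 ≤ z := by linarith
  set X := 1 / (1 - z) with hX
  have hX4 : 4 ≤ X := by
    rw [hX, le_div_iff₀ (by linarith)]
    linarith
  have hX0 : 0 < X := by linarith
  have hlogX : 0 < Real.log X := Real.log_pos (by linarith)
  set l := Real.sqrt (Real.log X) with hl
  have hl0 : 0 < l := Real.sqrt_pos.2 hlogX
  -- Below √X the trivial count suffices. Above it log K ≥ (log X)/2, so Landau's bound applies with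
  -- √(log X) in place of √(log K) at the cost of a factor 2; X ≥ 4 ensures K ≥ 2.
  have hpartial : ∀ K : ℕ, ∑ n ∈ range K, (if n ∈ S then (1 : ℝ) else 0) ≤
      Real.sqrt X + 2 * C / l * K := by
    intro K
    rw [sum_boole]
    rcases le_or_gt (K : ℝ) (Real.sqrt X) with hK | hK
    · have h1 : (((range K).filter fun n => n ∈ S).card : ℝ) ≤ K := by
        exact_mod_cast (card_filter_le _ _).trans (card_range K).le
      have h2 : 0 ≤ 2 * C / l * K := by positivity
      linarith
    · have hsX : 2 ≤ Real.sqrt X := by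
        refine Real.le_sqrt_of_sq_le ?_
        linarith
      have hK2 : 2 ≤ K := by
        have : (2 : ℝ) ≤ K := hsX.trans hK.le
        exact_mod_cast this
      have h1 := hcount K hK2 ((range K).filter fun n => n ∈ S) fun n hn => by
        rw [mem_filter, mem_range] at hn
        exact ⟨(hS n hn.2).1, hn.1.le, (hS n hn.2).2⟩
      have hlK : l / 2 ≤ Real.sqrt (Real.log K) := by
        refine Real.le_sqrt_of_sq_le ?_
        have h3 : Real.log (Real.sqrt X) ≤ Real.log K :=
          Real.log_le_log (by linarith) hK.le
        rw [Real.log_sqrt hX0.le] at h3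
        have h4 : l ^ 2 = Real.log X := Real.sq_sqrt hlogX.le
        rw [div_pow, h4]
        linarith
      have h2 : C * (K / Real.sqrt (Real.log K)) ≤ C * (K / (l / 2)) := by gcongr
      have h3 : C * ((K : ℝ) / (l / 2)) = 2 * C / l * K := by field_simp
      have := Real.sqrt_nonneg X
      linarith
  have hsum : ∑' n : S, z ^ (n : ℕ) = ∑' n : ℕ, (if n ∈ S then (1 : ℝ) else 0) * z ^ n := by
    rw [tsum_subtype S (fun n => z ^ n)]
    refine tsum_congr fun n => ?_
    by_cases h : n ∈ S <;> simp [h]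
  rw [hsum]
  have hle : ∑' n : ℕ, (if n ∈ S then (1 : ℝ) else 0) * z ^ n ≤
      Real.sqrt X + 2 * C / l * X := by
    refine Real.tsum_le_of_sum_range_le (fun n => ?_)
      (sum_mul_pow_le_of_sum_le_affine (Real.sqrt_nonneg X) (by positivity) hpartial hz0 hz1)
    split_ifs <;> positivity
  refine hle.trans ?_
  have e : 1 / ((1 - z) * l) = X / l := by
    rw [hX]; field_simp
  have h1 : Real.sqrt X ≤ X / l := by
    rw [le_div_iff₀ hl0]
    have h2 : l ≤ Real.sqrt X := by
      refine Real.sqrt_le_sqrt ?_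
      have := Real.log_le_sub_one_of_pos hX0
      linarith
    calc Real.sqrt X * l ≤ Real.sqrt X * Real.sqrt X := by gcongr
      _ = X := Real.mul_self_sqrt hX0.le
  rw [e]
  have h2 : 2 * C / l * X = 2 * C * (X / l) := by ring
  rw [h2]
  linarith

theorem mainTheorem3 :
    -- both power series converge on the interval `(-1, 1)`
    (∀ z : ℝ, |z| < 1 →
      Summable (fun n : {n : ℕ // 1 ≤ n} => (p3 n : ℝ) * z ^ (n : ℕ)) ∧
      Summable (fun n : {n : ℕ // 1 ≤ n ∧ 0 < p3 n} => z ^ (n : ℕ))) ∧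
    (fun z : ℝ => ∑' n : {n : ℕ // 1 ≤ n}, (p3 n : ℝ) * z ^ (n : ℕ))
      =O[𝓝[<] 1] (fun z : ℝ => 1 / (1 - z)) ∧
    (fun z : ℝ => ∑' n : {n : ℕ // 1 ≤ n ∧ 0 < p3 n}, z ^ (n : ℕ))
      =O[𝓝[<] 1] (fun z : ℝ => 1 / ((1 - z) * Real.sqrt (Real.log (1 / (1 - z))))) := by
  have hev : ∀ᶠ z : ℝ in 𝓝[<] 1, 3 / 4 < z ∧ z < 1 := Ioo_mem_nhdsLT (by norm_num)
  refine ⟨fun z hz => ⟨?_, ?_⟩, ?_, ?_⟩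
  · exact (summable_p3 hz).comp_injective Subtype.val_injective
  · exact (summable_geometric_of_abs_lt_one hz).comp_injective Subtype.val_injective
  · refine IsBigO.of_bound 1 ?_
    filter_upwards [hev] with z hz
    rw [one_mul, Real.norm_eq_abs]
    exact (abs_tsum_p3_le (by linarith) hz.2).trans (le_abs_self _)
  · obtain ⟨C, hC⟩ := exists_tsum_pow_le_of_sum_two_squares {n | 1 ≤ n ∧ 0 < p3 n}
      fun n hn => ⟨hn.1, exists_sq_add_sq_of_p3_ne_zero hn.2.ne'⟩
    refine IsBigO.of_bound C ?_
    filter_upwards [hev] with z hz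
    have hz1 : 0 < 1 - z := by linarith [hz.2]
    have hz0 : 0 ≤ z := by linarith [hz.1]
    rw [Real.norm_of_nonneg (tsum_nonneg fun n => pow_nonneg hz0 _),
      Real.norm_of_nonneg (by positivity)]
    exact hC z hz.1.le hz.2
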